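/- Let $\mathcal X,\mathcal Y$ be finite alphabets, $W,V$ two discrete memoryless channels from $\mathcal X$ to $\mathcal Y$, $P_X$ a distribution on $\mathcal X$, $R\ge 0$ and $\alpha\ge 0$. A code of rate $R$ and blocklength $n$ is a list $\mathcal C_n=(\mathbf x_1,\dots,\mathbf x_M)$ of $M=\lceil e^{nR}\rceil$ words of $\mathcal X^n$. The low-rate simplified detector/decoder $\phi_L$ with parameter $\alpha$ rejects (declares $V$) exactly when $\mathbf y$ lies in $$\mathcal R_{0,L}=\Big\{\mathbf y:\ e^{n\alpha}\max_{m}W(\mathbf y|\mathbf x_m)<\max_{m}V(\mathbf y|\mathbf x_m)\Big\}.$$ Put $P_{FA}(\mathcal C_n)=\frac1M\sum_m W(\mathcal R_{0,L}|\mathbf x_m)$, $P_{MD}(\mathcal C_n)=\frac1M\sum_m V(\mathcal R_{0,L}^c|\mathbf x_m)$, and for a code sequence $\mathcal C=\{\mathcal C_n\}$ put $E_{FA}(\mathcal C,\phi_L)=\liminf_n -\frac1n\log P_{FA}(\mathcal C_n)$, $E_{MD}(\mathcal C,\phi_L)=\liminf_n -\frac1n\log P_{MD}(\mathcal C_n)$.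 All joint distributions $Q,\tilde Q,\overline Q$ below are on $\mathcal X\times\mathcal Y$ and have $\mathcal X$-marginal $P_X$; the infimum over an empty set is $\infty$. Let $f_W(Q)=\sum_{x,y}Q(x,y)\log W(y|x)\in[-\infty,0]$, and for $a\in\mathbb R$ $$\mathbf t_a(q,\gamma)=\inf\{I(Q):\ Q_Y=q,\ f_W(Q)>-\infty,\ -a-f_W(Q)+\gamma\le 0\}.$$ For $r,a\in\mathbb R$ let $$E_{A}=\inf\{D(\tilde Q_{Y|X}\|W|P_X):\ f_W(\tilde Q)\le -a+f_V(\tilde Q),\ \mathbf t_a(\tilde Q_Y,f_V(\tilde Q))\ge r\},$$ $$E_{B}=\inf\{D(\tilde Q_{Y|X}\|W|P_X)+[I(\overline Q)-r]_+\},$$ where the second infimum is over the pairs $(\tilde Q,\overline Q)$ with $\overline Q_Y=\tilde Q_Y$, $f_W(\overline Q)\le -a+f_V(\overline Q)$, $f_V(\overline Q)\ge a+f_W(\tilde Q)$ and $\mathbf t_a(\tilde Q_Y,f_V(\overline Q))\ge r$. Let $E_L^{RC}(r,a,P_X,W,V)=\min\{E_A,E_B\}$; in $E_L^{RC}(r,a,P_X,V,W)$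 the roles of $W$ and $V$ are exchanged throughout. Then there is a sequence of codes $\mathcal C$ of rate $R$ such that for every $\delta>0$: (i) if $(r,a)\mapsto E_L^{RC}(r,a,P_X,W,V)$ is lower semicontinuous at $(R,\alpha)$, then $E_{FA}(\mathcal C,\phi_L)\ge E_L^{RC}(R,\alpha,P_X,W,V)-\delta$; (ii) if $(r,a)\mapsto E_L^{RC}(r,a,P_X,V,W)$ is lower semicontinuous at $(R,-\alpha)$, then $E_{MD}(\mathcal C,\phi_L)\ge E_L^{RC}(R,-\alpha,P_X,V,W)-\delta$; (iii) without any continuity assumption, $E_{FA}(\mathcal C,\phi_L)\ge E_L^{RC}(R-\delta,\alpha-\delta,P_X,W,V)-\delta$ and $E_{MD}(\mathcal C,\phi_L)\ge E_L^{RC}(R-\delta,-\alpha-\delta,P_X,V,W)-\delta$. -/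

import Mathlib

open Filter Topology

noncomputable section

namespace DetDec

/-! ### Channels, codes, and the low-rate simplified detector -/

section Operational

variable {X Y : Type*} [Fintype X] [Fintype Y]

/-- `W x y` is the transition probability `W(y|x)` of a discrete memoryless channel. -/
def IsChannel (W : X → Y → ℝ) : Prop := ∀ x, W x ∈ stdSimplex ℝ Y

/-- The memoryless extension `W(𝐲|𝐱) = ∏ᵢ W(yᵢ|xᵢ)`. -/
def blockProb {n : ℕ} (W : X → Y → ℝ) (x : Fin n → X) (y : Fin n → Y) : ℝ :=
  ∏ i, W (x i) (y i)

/-- The number `M = ⌈e^{nR}⌉` of codewords of a code of rate `R` and blocklength `n`. -/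
def codeSize (R : ℝ) (n : ℕ) : ℕ := ⌈Real.exp (n * R)⌉₊

/-- A codebook of `M` codewords `𝐱₁, …, 𝐱_M` of blocklength `n`. -/
abbrev Codebook (X : Type*) (M n : ℕ) : Type _ := Fin M → Fin n → X

/-- A sequence of codes of rate `R`, one for each blocklength. -/
abbrev CodeSeq (X : Type*) (R : ℝ) : Type _ := (n : ℕ) → Codebook X (codeSize R n) n

/-- The rejection region of the low-rate simplified detector/decoder with parameter `α`:
`{𝐲 : e^{nα} max_m W(𝐲|𝐱_m) < max_m V(𝐲|𝐱_m)}`. -/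
def rejectL {M n : ℕ} (W V : X → Y → ℝ) (α : ℝ) (c : Codebook X M n) : Set (Fin n → Y) :=
  {y | Real.exp (n * α) * (⨆ m, blockProb W (c m) y) < ⨆ m, blockProb V (c m) y}

/-- `(1/M) ∑_m U(A|𝐱_m)`: the probability that the output of the channel `U` lies in `A` when a
uniformly chosen codeword is sent. -/
def outputProb {M n : ℕ} (U : X → Y → ℝ) (c : Codebook X M n) (A : Set (Fin n → Y)) : ℝ :=
  (1 / (M : ℝ)) * ∑ m, ∑ y, A.indicator (blockProb U (c m)) y

/-- The false alarm probability `(1/M) ∑_m W(𝓡₀|𝐱_m)` for the rejection region `R₀`. -/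
def probFA {M n : ℕ} (W : X → Y → ℝ) (c : Codebook X M n) (R₀ : Set (Fin n → Y)) : ℝ :=
  outputProb W c R₀

/-- The misdetection probability `(1/M) ∑_m V(𝓡₀ᶜ|𝐱_m)` for the rejection region `R₀`. -/
def probMD {M n : ℕ} (V : X → Y → ℝ) (c : Codebook X M n) (R₀ : Set (Fin n → Y)) : ℝ :=
  outputProb V c R₀ᶜ

/-- `liminf_n -(1/n) log pₙ` in `[-∞, ∞]`, with `-log 0 = ∞`. -/
def exponent (p : ℕ → ℝ) : EReal :=
  liminf (fun n : ℕ => if p n = 0 then (⊤ : EReal)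
    else ((-(1 / (n : ℝ)) * Real.log (p n) : ℝ) : EReal)) atTop

/-- The FA exponent of a code sequence under the low-rate simplified detector. -/
def exponentFA (W V : X → Y → ℝ) {R : ℝ} (α : ℝ) (C : CodeSeq X R) : EReal :=
  exponent fun n => probFA W (C n) (rejectL W V α (C n))

/-- The MD exponent of a code sequence under the low-rate simplified detector. -/
def exponentMD (W V : X → Y → ℝ) {R : ℝ} (α : ℝ) (C : CodeSeq X R) : EReal :=
  exponent fun n => probMD V (C n) (rejectL W V α (C n))

end Operational

/-! ### Single-letter quantities -/

section SingleLetter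

variable {X Y : Type*} [Fintype X] [Fintype Y]

/-- The `X`-marginal. -/
def margX (Q : X → Y → ℝ) (x : X) : ℝ := ∑ y, Q x y

/-- The `Y`-marginal. -/
def margY (Q : X → Y → ℝ) (y : Y) : ℝ := ∑ x, Q x y

/-- The joint distributions `Q` on `X × Y` with `X`-marginal `P`. -/
def joints (P : X → ℝ) : Set (X → Y → ℝ) :=
  {Q | (∀ x y, 0 ≤ Q x y) ∧ ∑ x, ∑ y, Q x y = 1 ∧ margX Q = P}

/-- The mutual information `I(Q)`, in nats. -/
def mutualInfo (Q : X → Y → ℝ) : ℝ :=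
  ∑ x, ∑ y, Q x y * Real.log (Q x y / (margX Q x * margY Q y))

open Classical in
/-- The conditional divergence `D(Q_{Y|X} ‖ W | Q_X)`, in `[0, ∞]`. -/
def condDiv (Q W : X → Y → ℝ) : EReal :=
  if ∃ x y, 0 < Q x y ∧ W x y = 0 then ⊤
  else ((∑ x, ∑ y, Q x y * Real.log ((Q x y / margX Q x) / W x y) : ℝ) : EReal)

open Classical in
/-- `f_W(Q) = ∑ Q(x,y) log W(y|x)`, with `log 0 = -∞` and `0 · (-∞) = 0`. -/
def loglik (W Q : X → Y → ℝ) : EReal :=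
  if ∃ x y, 0 < Q x y ∧ W x y = 0 then ⊥
  else ((∑ x, ∑ y, Q x y * Real.log (W x y) : ℝ) : EReal)

/-- `𝐭(q, γ)`: the minimum of `I(Q)` over the joint distributions `Q` with `X`-marginal `P` and
`Y`-marginal `q` for which `f_W(Q) > -∞` and `-α - f_W(Q) + γ ≤ 0` (`∞` if there is none). -/
def tL (α : ℝ) (P : X → ℝ) (W : X → Y → ℝ) (q : Y → ℝ) (γ : EReal) : EReal :=
  ⨅ Q ∈ {Q : X → Y → ℝ | Q ∈ joints P ∧ margY Q = q ∧ ⊥ < loglik W Q ∧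
      -(α : EReal) - loglik W Q + γ ≤ 0}, (mutualInfo Q : EReal)

/-- The domain of the minimization that defines `E_A`. -/
def domA (R α : ℝ) (P : X → ℝ) (W V : X → Y → ℝ) : Set (X → Y → ℝ) :=
  {Q | Q ∈ joints P ∧
    loglik W Q ≤ -(α : EReal) + loglik V Q ∧
    (R : EReal) ≤ tL α P W (margY Q) (loglik V Q)}

/-- `E_A`, the exponent of the event that the transmitted codeword causes the error. -/
def expA (R α : ℝ) (P : X → ℝ) (W V : X → Y → ℝ) : EReal :=
  ⨅ Q ∈ domA R α P W V, condDiv Q W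

/-- The domain of the minimization that defines `E_B`: pairs `(Q̃, Q̄)`. -/
def domB (R α : ℝ) (P : X → ℝ) (W V : X → Y → ℝ) : Set ((X → Y → ℝ) × (X → Y → ℝ)) :=
  {q | q.1 ∈ joints P ∧ q.2 ∈ joints P ∧
    margY q.2 = margY q.1 ∧
    loglik W q.2 ≤ -(α : EReal) + loglik V q.2 ∧
    (α : EReal) + loglik W q.1 ≤ loglik V q.2 ∧
    (R : EReal) ≤ tL α P W (margY q.1) (loglik V q.2)}

/-- `E_B`, the exponent of the event that a competing codeword causes the error. -/
def expB (R α : ℝ) (P : X → ℝ) (W V : X → Y → ℝ) : EReal :=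
  ⨅ q ∈ domB R α P W V,
    (condDiv q.1 W + ((max (mutualInfo q.2 - R) 0 : ℝ) : EReal))

/-- The low-rate detection random coding exponent `E_L(R, α, P, W, V) = min {E_A, E_B}`. -/
def expRC (R α : ℝ) (P : X → ℝ) (W V : X → Y → ℝ) : EReal :=
  min (expA R α P W V) (expB R α P W V)

end SingleLetter

end DetDec

end

open DetDec

set_option linter.unusedSectionVars false

noncomputable section

/-! The proof is a random coding argument over a constant composition ensemble. The codewords are
drawn independently and uniformly from one type class, whose type approximates `P` and vanishes
wherever `P` does. Both error events lie in a dominance event: some codeword satisfies `exp (n a)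
W(y|x_j) ≤ V(y|x_m)` against every `j`. Misdetection is the same event with `W` and `V` exchanged
and `a = -α`, so one analysis serves both.

Dominance by a word `x'` over the output `y` must survive all the other codewords. If a fraction
`exp (-n r)` or more of the type class would prevent it, with `r` slightly below `R`, then about
`exp (n R)` independent draws all miss that fraction only with doubly exponentially small
probability (`card_isAtypical_le`). For the remaining codes the preventing fraction is smaller, and
`IsErrorTriple` records this. By the method of types a small fraction means `𝐭 ≥ r` up to slack: a
joint distribution of smaller mutual information and sufficient likelihood would yield too many
preventing words (`exists_card_likelihood_ge`). A transmitted word that dominates by itself yields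
`E_A`. For a competitor, the union bound over the codebook, capped at one, turns `exp (-n I)` into
`exp (-n [I - R]_+)` and yields `E_B` (`card_errorTriple_le`, `sum_tripleProb_le`).

The passage from empirical types to distributions with `X`-marginal exactly `P` is the delicate
point, since `W` and `V` may have zeros and `f_W` may be `-∞`. Entropies and dominated likelihoods
are continuous, but supports must be kept under control; this is the role of
`exists_close_same_margins` and `exists_joint_perturbation`, combined in
`exponents_le_of_isErrorTriple`. Integer rounding of transport matrices (`exists_nat_matrix`) turns
an ideal distribution back into an actual joint type with a prescribed output word.

For each fixed slack a Markov argument selects one code good for both errors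
(`eventually_exists_code`). A diagonal choice with slack tending to zero gives one sequence.
Monotonicity of the exponent then gives the unconditional bounds, and lower semicontinuity removes
the slack. -/

namespace DetDec

/-! ### Continuous formulas for divergence, likelihood and mutual information. -/

section Formulas

variable {X Y : Type*} [Fintype X] [Fintype Y]

/-- `Q(x, y) = 0` wherever `W(y|x) = 0`. -/
def Dominated (Q W : X → Y → ℝ) : Prop := ∀ x y, W x y = 0 → Q x y = 0

/-- `∑ Q(x,y) log W(y|x)` with the convention `log 0 = 0`. -/
def linLog (W Q : X → Y → ℝ) : ℝ := ∑ x, ∑ y, Q x y * Real.log (W x y)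

/-- A globally continuous formula for the conditional divergence. -/
def divFormula (W Q : X → Y → ℝ) : ℝ :=
  ∑ x, ∑ y, Q x y * Real.log (Q x y) - ∑ x, margX Q x * Real.log (margX Q x) - linLog W Q

/-- A globally continuous formula for the mutual information. -/
def infoFormula (Q : X → Y → ℝ) : ℝ :=
  ∑ x, ∑ y, Q x y * Real.log (Q x y) - ∑ x, margX Q x * Real.log (margX Q x)
    - ∑ y, margY Q y * Real.log (margY Q y)

theorem not_exists_of_dominated {Q W : X → Y → ℝ} (h : Dominated Q W) :
    ¬ ∃ x y, 0 < Q x y ∧ W x y = 0 := by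
  rintro ⟨x, y, h1, h2⟩
  exact h1.ne' (h x y h2)

theorem dominated_of_not_exists {Q W : X → Y → ℝ} (hQ : ∀ x y, 0 ≤ Q x y)
    (h : ¬ ∃ x y, 0 < Q x y ∧ W x y = 0) : Dominated Q W := by
  intro x y hw
  by_contra hne
  exact h ⟨x, y, lt_of_le_of_ne (hQ x y) (Ne.symm hne), hw⟩

theorem loglik_of_dominated {Q W : X → Y → ℝ} (h : Dominated Q W) :
    loglik W Q = (linLog W Q : EReal) := by
  rw [loglik, if_neg (not_exists_of_dominated h)]; rfl

theorem loglik_of_exists {Q W : X → Y → ℝ} (h : ∃ x y, 0 < Q x y ∧ W x y = 0) :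
    loglik W Q = ⊥ := if_pos h

theorem margX_nonneg {Q : X → Y → ℝ} (hQ : ∀ x y, 0 ≤ Q x y) (x : X) : 0 ≤ margX Q x :=
  Finset.sum_nonneg fun y _ => hQ x y

theorem le_margX {Q : X → Y → ℝ} (hQ : ∀ x y, 0 ≤ Q x y) (x : X) (y : Y) : Q x y ≤ margX Q x :=
  Finset.single_le_sum (f := fun y => Q x y) (fun y _ => hQ x y) (Finset.mem_univ y)

theorem le_margY {Q : X → Y → ℝ} (hQ : ∀ x y, 0 ≤ Q x y) (x : X) (y : Y) : Q x y ≤ margY Q y :=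
  Finset.single_le_sum (f := fun x => Q x y) (fun x _ => hQ x y) (Finset.mem_univ x)

/-- Domination makes every factor positive wherever `Q` is, so the logarithm splits term by term.
The resulting expression is continuous on all matrices, because `t log t` is continuous at zero. -/
theorem condDiv_of_dominated {Q W : X → Y → ℝ} (hQ : ∀ x y, 0 ≤ Q x y) (h : Dominated Q W) :
    condDiv Q W = (divFormula W Q : EReal) := by
  rw [condDiv, if_neg (not_exists_of_dominated h)]
  congr 1
  rw [divFormula, linLog, ← Finset.sum_sub_distrib, ← Finset.sum_sub_distrib]
  refine Finset.sum_congr rfl fun x _ => ?_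
  have : margX Q x * Real.log (margX Q x) = ∑ y, Q x y * Real.log (margX Q x) := by
    rw [← Finset.sum_mul]; rfl
  rw [this, ← Finset.sum_sub_distrib, ← Finset.sum_sub_distrib]
  refine Finset.sum_congr rfl fun y _ => ?_
  rcases (hQ x y).eq_or_lt with h0 | h0
  · rw [← h0]; simp
  · have hw : W x y ≠ 0 := fun hw => h0.ne' (h x y hw)
    have hm : 0 < margX Q x := h0.trans_le (le_margX hQ x y)
    rw [Real.log_div (by positivity) hw, Real.log_div h0.ne' hm.ne']
    ring

theorem mutualInfo_eq {Q : X → Y → ℝ} (hQ : ∀ x y, 0 ≤ Q x y) :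
    mutualInfo Q = infoFormula Q := by
  have h1 : ∑ y, margY Q y * Real.log (margY Q y)
      = ∑ x, ∑ y, Q x y * Real.log (margY Q y) := by
    rw [Finset.sum_comm]
    refine Finset.sum_congr rfl fun y _ => ?_
    rw [← Finset.sum_mul]; rfl
  rw [mutualInfo, infoFormula, h1, ← Finset.sum_sub_distrib, ← Finset.sum_sub_distrib]
  refine Finset.sum_congr rfl fun x _ => ?_
  have : margX Q x * Real.log (margX Q x) = ∑ y, Q x y * Real.log (margX Q x) := by
    rw [← Finset.sum_mul]; rfl
  rw [this, ← Finset.sum_sub_distrib, ← Finset.sum_sub_distrib]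
  refine Finset.sum_congr rfl fun y _ => ?_
  rcases (hQ x y).eq_or_lt with h0 | h0
  · rw [← h0]; simp
  · have hm : 0 < margX Q x := h0.trans_le (le_margX hQ x y)
    have hm' : 0 < margY Q y := h0.trans_le (le_margY hQ x y)
    rw [Real.log_div h0.ne' (by positivity), Real.log_mul hm.ne' hm'.ne']
    ring

theorem blockProb_nonneg {W : X → Y → ℝ} (hW : ∀ a b, 0 ≤ W a b) {n : ℕ}
    (x : Fin n → X) (y : Fin n → Y) : 0 ≤ blockProb W x y :=
  Finset.prod_nonneg fun _ _ => hW _ _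

theorem continuous_margX : Continuous (margX : (X → Y → ℝ) → X → ℝ) := by
  unfold margX; fun_prop

theorem continuous_margY : Continuous (margY : (X → Y → ℝ) → Y → ℝ) := by
  unfold margY; fun_prop

theorem continuous_linLog (W : X → Y → ℝ) : Continuous (linLog W) := by
  unfold linLog; fun_prop

theorem continuous_sum_mul_log :
    Continuous fun Q : X → Y → ℝ => ∑ x, ∑ y, Q x y * Real.log (Q x y) :=
  continuous_finsetSum _ fun x _ => continuous_finsetSum _ fun y _ =>
    Real.continuous_mul_log.comp ((continuous_apply y).comp (continuous_apply x))

theorem continuous_margX_mul_log :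
    Continuous fun Q : X → Y → ℝ => ∑ x, margX Q x * Real.log (margX Q x) :=
  continuous_finsetSum _ fun x _ =>
    Real.continuous_mul_log.comp ((continuous_apply x).comp continuous_margX)

theorem continuous_margY_mul_log :
    Continuous fun Q : X → Y → ℝ => ∑ y, margY Q y * Real.log (margY Q y) :=
  continuous_finsetSum _ fun y _ =>
    Real.continuous_mul_log.comp ((continuous_apply y).comp continuous_margY)

theorem continuous_divFormula (W : X → Y → ℝ) : Continuous (divFormula W) :=
  (continuous_sum_mul_log.sub continuous_margX_mul_log).sub (continuous_linLog W)

theorem continuous_infoFormula : Continuous (infoFormula : (X → Y → ℝ) → ℝ) :=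
  (continuous_sum_mul_log.sub continuous_margX_mul_log).sub continuous_margY_mul_log

/-- A continuous function of a matrix is uniformly continuous on matrices with entries in
`[0, 1]`. -/
theorem exists_uniform_dist {F : (X → Y → ℝ) → ℝ} (hF : Continuous F) {ε : ℝ} (hε : 0 < ε) :
    ∃ η > 0, ∀ Q ∈ Set.Icc (0 : X → Y → ℝ) 1, ∀ Q' ∈ Set.Icc (0 : X → Y → ℝ) 1,
      dist Q Q' ≤ η → |F Q - F Q'| ≤ ε := by
  have hc : IsCompact (Set.Icc (0 : X → Y → ℝ) 1) := isCompact_Icc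
  have hu := hc.uniformContinuousOn_of_continuous hF.continuousOn
  rw [Metric.uniformContinuousOn_iff] at hu
  obtain ⟨η, hη, h⟩ := hu ε hε
  refine ⟨η / 2, by positivity, fun Q hQ Q' hQ' hd => ?_⟩
  exact (h Q hQ Q' hQ' (by linarith)).le

theorem sum_sum_eq_sum_margY (Q : X → Y → ℝ) : ∑ x, ∑ y, Q x y = ∑ y, margY Q y := by
  rw [Finset.sum_comm]; rfl

theorem le_one_of_sum {Q : X → Y → ℝ} (hQ : ∀ x y, 0 ≤ Q x y) (h1 : ∑ x, ∑ y, Q x y = 1) :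
    Q ∈ Set.Icc (0 : X → Y → ℝ) 1 := by
  refine ⟨fun x y => hQ x y, fun x y => ?_⟩
  refine (le_margX hQ x y).trans ?_
  rw [Pi.one_apply, Pi.one_apply, ← h1]
  exact Finset.single_le_sum (f := fun x => margX Q x) (fun x _ => margX_nonneg hQ x)
    (Finset.mem_univ x)

end Formulas

/-! ### Perturbing joint distributions while controlling margins and supports. -/

section Compactness

variable {X Y : Type*} [Fintype X] [Fintype Y]

/-- Transport polytopes depend lower semicontinuously on their margins: a matrix `B` whose margins
are close to those of `A` is close to a matrix with exactly the margins of `A`. -/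
theorem exists_close_same_margins (S : X → Y → Prop) {ε : ℝ} (hε : 0 < ε) :
    ∃ η > 0, ∀ A ∈ Set.Icc (0 : X → Y → ℝ) 1, ∀ B ∈ Set.Icc (0 : X → Y → ℝ) 1,
      (∀ x y, S x y → A x y = 0) → (∀ x y, S x y → B x y = 0) →
      dist (margX A) (margX B) ≤ η → dist (margY A) (margY B) ≤ η →
      ∃ B' : X → Y → ℝ, (∀ x y, 0 ≤ B' x y) ∧ (∀ x y, S x y → B' x y = 0) ∧
        margX B' = margX A ∧ margY B' = margY A ∧ dist B' B ≤ ε := by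
  by_contra! hcon
  have hpos : ∀ k : ℕ, (0 : ℝ) < 1 / ((k : ℝ) + 1) := fun k => by positivity
  choose A hA B hB hSA hSB hX hY hno using fun k : ℕ => hcon (1 / ((k : ℝ) + 1)) (hpos k)
  have hc : IsCompact (Set.Icc (0 : X → Y → ℝ) 1 ×ˢ Set.Icc (0 : X → Y → ℝ) 1) :=
    isCompact_Icc.prod isCompact_Icc
  obtain ⟨⟨a, b⟩, hab, φ, hφ, hlim⟩ := hc.tendsto_subseq (x := fun k => (A k, B k))
    fun k => ⟨hA k, hB k⟩
  have ha : Tendsto (fun k => A (φ k)) atTop (𝓝 a) :=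
    (continuous_fst.tendsto _).comp hlim
  have hb : Tendsto (fun k => B (φ k)) atTop (𝓝 b) :=
    (continuous_snd.tendsto _).comp hlim
  have h0 : Tendsto (fun k => 1 / (((φ k : ℕ) : ℝ) + 1)) atTop (𝓝 0) :=
    tendsto_one_div_add_atTop_nhds_zero_nat.comp hφ.tendsto_atTop
  have hmX : margX a = margX b := by
    have h1 : Tendsto (fun k => dist (margX (A (φ k))) (margX (B (φ k)))) atTop
        (𝓝 (dist (margX a) (margX b))) :=
      ((continuous_margX.tendsto _).comp ha).dist ((continuous_margX.tendsto _).comp hb)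
    exact dist_le_zero.1 (le_of_tendsto_of_tendsto' h1 h0 fun k => hX (φ k))
  have hmY : margY a = margY b := by
    have h1 : Tendsto (fun k => dist (margY (A (φ k))) (margY (B (φ k)))) atTop
        (𝓝 (dist (margY a) (margY b))) :=
      ((continuous_margY.tendsto _).comp ha).dist ((continuous_margY.tendsto _).comp hb)
    exact dist_le_zero.1 (le_of_tendsto_of_tendsto' h1 h0 fun k => hY (φ k))
  have hentry : ∀ {u : ℕ → X → Y → ℝ} {l : X → Y → ℝ}, Tendsto u atTop (𝓝 l) → ∀ x y,
      Tendsto (fun k => u k x y) atTop (𝓝 (l x y)) := fun h x y =>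
    ((continuous_apply y).tendsto _).comp (((continuous_apply x).tendsto _).comp h)
  have hSa : ∀ x y, S x y → a x y = 0 := fun x y hs =>
    tendsto_nhds_unique (hentry ha x y) (by simp [hSA _ x y hs])
  have hSb : ∀ x y, S x y → b x y = 0 := fun x y hs =>
    tendsto_nhds_unique (hentry hb x y) (by simp [hSB _ x y hs])
  -- the fraction of the limiting circulation that is kept
  obtain ⟨t, ht0, ht1, ht2⟩ : ∃ t : ℝ, 0 < t ∧ t ≤ 1 ∧ t * dist a b ≤ ε / 4 := by
    refine ⟨min 1 (ε / 4 / (dist a b + 1)), ?_, min_le_left _ _, ?_⟩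
    · have : 0 ≤ dist a b := dist_nonneg
      positivity
    · have hd : 0 ≤ dist a b := dist_nonneg
      calc _ ≤ ε / 4 / (dist a b + 1) * dist a b := by gcongr; exact min_le_right _ _
        _ ≤ ε / 4 / (dist a b + 1) * (dist a b + 1) := by gcongr; linarith
        _ = ε / 4 := by field_simp
  -- The candidate `A - (1 - t)(a - b)` has the margins of `A` because `a` and `b` have equal
  -- margins. Where `a ≤ b` nothing is subtracted. Where `a > b` the limit `t a + (1 - t) b` is
  -- strictly positive; this is why `t > 0` is kept, as `b` may vanish there.
  have hnn : ∀ x y, ∀ᶠ k in atTop, 0 ≤ A (φ k) x y - (1 - t) * (a x y - b x y) := by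
    intro x y
    rcases le_or_gt (a x y) (b x y) with h | h
    · refine Eventually.of_forall fun k => ?_
      have := (hA (φ k)).1 x y
      simp only [Pi.zero_apply] at this
      nlinarith
    · have h1 : Tendsto (fun k => A (φ k) x y - (1 - t) * (a x y - b x y)) atTop
          (𝓝 (a x y - (1 - t) * (a x y - b x y))) := (hentry ha x y).sub_const _
      refine (h1.eventually_const_lt ?_).mono fun k hk => hk.le
      have := hab.2.1 x y
      simp only [Pi.zero_apply] at this
      nlinarith
  have hclose : ∀ᶠ k in atTop, dist (A (φ k)) a < ε / 4 := by
    exact (Metric.tendsto_nhds.1 ha) _ (by positivity)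
  have hclose' : ∀ᶠ k in atTop, dist (B (φ k)) b < ε / 4 := by
    exact (Metric.tendsto_nhds.1 hb) _ (by positivity)
  have hall : ∀ᶠ k in atTop, ∀ x y, 0 ≤ A (φ k) x y - (1 - t) * (a x y - b x y) := by
    simp only [eventually_all]; exact hnn
  obtain ⟨k, hk1, hk2, hk3⟩ := (hall.and (hclose.and hclose')).exists
  have hlt := hno (φ k) (fun x y => A (φ k) x y - (1 - t) * (a x y - b x y)) hk1
    (fun x y hs => by rw [hSA _ x y hs, hSa x y hs, hSb x y hs]; ring) ?_ ?_
  · refine absurd hlt (not_lt.2 ?_)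
    refine (dist_pi_le_iff hε.le).2 fun x => (dist_pi_le_iff hε.le).2 fun y => ?_
    have e1 : |A (φ k) x y - a x y| ≤ dist (A (φ k)) a :=
      (dist_le_pi_dist (A (φ k) x) (a x) y).trans (dist_le_pi_dist _ _ x)
    have e2 : |B (φ k) x y - b x y| ≤ dist (B (φ k)) b :=
      (dist_le_pi_dist (B (φ k) x) (b x) y).trans (dist_le_pi_dist _ _ x)
    have e3 : |a x y - b x y| ≤ dist a b :=
      (dist_le_pi_dist (a x) (b x) y).trans (dist_le_pi_dist _ _ x)
    have e4 : |t * (a x y - b x y)| ≤ ε / 4 := by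
      rw [abs_mul, abs_of_pos ht0]
      exact (mul_le_mul_of_nonneg_left e3 ht0.le).trans ht2
    rw [Real.dist_eq]
    have : A (φ k) x y - (1 - t) * (a x y - b x y) - B (φ k) x y
      = (A (φ k) x y - a x y) - (B (φ k) x y - b x y) + t * (a x y - b x y) := by ring
    rw [this, abs_le]
    rw [abs_le] at e1 e2 e4
    constructor <;> linarith [e1.1, e1.2, e2.1, e2.2, e4.1, e4.2]
  · funext x
    have := congrFun hmX x
    simp only [margX] at this ⊢
    rw [Finset.sum_sub_distrib, ← Finset.mul_sum, Finset.sum_sub_distrib, this]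
    ring
  · funext y
    have := congrFun hmY y
    simp only [margY] at this ⊢
    rw [Finset.sum_sub_distrib, ← Finset.mul_sum, Finset.sum_sub_distrib, this]
    ring

/-- Pairs of dominated joint distributions with a common `Y`-marginal whose `X`-marginals are close
to `P` are close to such pairs with `X`-marginals equal to `P`. -/
theorem exists_close_pair (W V : X → Y → ℝ) (P : X → ℝ) {ε : ℝ} (hε : 0 < ε) :
    ∃ η > 0, ∀ A B : X → Y → ℝ, (∀ x y, 0 ≤ A x y) → (∀ x y, 0 ≤ B x y) →
      ∑ x, ∑ y, A x y = 1 → Dominated A W → Dominated B V → margY B = margY A →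
      dist (margX A) P ≤ η → dist (margX B) P ≤ η →
      ∃ A' B' : X → Y → ℝ, A' ∈ joints P ∧ B' ∈ joints P ∧ Dominated A' W ∧ Dominated B' V ∧
        margY B' = margY A' ∧ dist A A' ≤ ε ∧ dist B B' ≤ ε := by
  by_contra! hcon
  have hpos : ∀ k : ℕ, (0 : ℝ) < 1 / ((k : ℝ) + 1) := fun k => by positivity
  choose A B hA hB hA1 hAW hBV hY hXA hXB hno using
    fun k : ℕ => hcon (1 / ((k : ℝ) + 1)) (hpos k)
  have hB1 : ∀ k, ∑ x, ∑ y, B k x y = 1 := fun k => by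
    rw [sum_sum_eq_sum_margY, hY, ← sum_sum_eq_sum_margY, hA1]
  have hc : IsCompact (Set.Icc (0 : X → Y → ℝ) 1 ×ˢ Set.Icc (0 : X → Y → ℝ) 1) :=
    isCompact_Icc.prod isCompact_Icc
  obtain ⟨⟨a, b⟩, hab, φ, hφ, hlim⟩ := hc.tendsto_subseq (x := fun k => (A k, B k))
    fun k => ⟨le_one_of_sum (hA k) (hA1 k), le_one_of_sum (hB k) (hB1 k)⟩
  have ha : Tendsto (fun k => A (φ k)) atTop (𝓝 a) :=
    (continuous_fst.tendsto _).comp hlim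
  have hb : Tendsto (fun k => B (φ k)) atTop (𝓝 b) :=
    (continuous_snd.tendsto _).comp hlim
  have h0 : Tendsto (fun k => 1 / (((φ k : ℕ) : ℝ) + 1)) atTop (𝓝 0) :=
    tendsto_one_div_add_atTop_nhds_zero_nat.comp hφ.tendsto_atTop
  have hentry : ∀ {u : ℕ → X → Y → ℝ} {l : X → Y → ℝ}, Tendsto u atTop (𝓝 l) → ∀ x y,
      Tendsto (fun k => u k x y) atTop (𝓝 (l x y)) := fun h x y =>
    ((continuous_apply y).tendsto _).comp (((continuous_apply x).tendsto _).comp h)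
  have haX : margX a = P := by
    have h1 : Tendsto (fun k => dist (margX (A (φ k))) P) atTop (𝓝 (dist (margX a) P)) :=
      ((continuous_margX.tendsto _).comp ha).dist tendsto_const_nhds
    exact dist_le_zero.1 (le_of_tendsto_of_tendsto' h1 h0 fun k => hXA (φ k))
  have hbX : margX b = P := by
    have h1 : Tendsto (fun k => dist (margX (B (φ k))) P) atTop (𝓝 (dist (margX b) P)) :=
      ((continuous_margX.tendsto _).comp hb).dist tendsto_const_nhds
    exact dist_le_zero.1 (le_of_tendsto_of_tendsto' h1 h0 fun k => hXB (φ k))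
  have hmY : margY b = margY a :=
    tendsto_nhds_unique ((continuous_margY.tendsto _).comp hb)
      (by simpa only [Function.comp_def, hY] using (continuous_margY.tendsto _).comp ha)
  have hsum : Continuous fun Q : X → Y → ℝ => ∑ x, ∑ y, Q x y := by fun_prop
  have ha1 : ∑ x, ∑ y, a x y = 1 :=
    tendsto_nhds_unique ((hsum.tendsto _).comp ha) (by simp [Function.comp_def, hA1])
  have hb1 : ∑ x, ∑ y, b x y = 1 :=
    tendsto_nhds_unique ((hsum.tendsto _).comp hb) (by simp [Function.comp_def, hB1])
  have haW : Dominated a W := fun x y hs =>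
    tendsto_nhds_unique (hentry ha x y) (by simp [hAW _ x y hs])
  have hbV : Dominated b V := fun x y hs =>
    tendsto_nhds_unique (hentry hb x y) (by simp [hBV _ x y hs])
  -- The limit pair has the exact margins, and its support constraints are closed conditions, so it
  -- is itself the pair that was supposed not to exist.
  obtain ⟨k, hk1, hk2⟩ := (((Metric.tendsto_nhds.1 ha) _ hε).and
    ((Metric.tendsto_nhds.1 hb) _ hε)).exists
  exact absurd (hno (φ k) a b ⟨fun x y => hab.1.1 x y, ha1, haX⟩
    ⟨fun x y => hab.2.1 x y, hb1, hbX⟩ haW hbV hmY hk1.le) (not_lt.2 hk2.le)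

/-- Move a joint distribution to the `X`-marginal `P`: shrink it by `c` and put the missing mass on
the graph of `s`. -/
def shiftMarg [DecidableEq Y] (P : X → ℝ) (s : X → Y) (c : ℝ) (Q : X → Y → ℝ) : X → Y → ℝ :=
  fun x y => c * Q x y + if y = s x then P x - c * margX Q x else 0

theorem margX_shiftMarg [DecidableEq Y] (P : X → ℝ) (s : X → Y) (c : ℝ) (Q : X → Y → ℝ) :
    margX (shiftMarg P s c Q) = P := by
  funext x
  simp only [margX, shiftMarg, Finset.sum_add_distrib, ← Finset.mul_sum, Finset.sum_ite_eq',
    Finset.mem_univ, if_true]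
  ring

/-- The mass placed on the graph of `s` depends on `Q` only through its `X`-marginal. Two
distributions with common margins can therefore be shifted together without separating their
`Y`-marginals. -/
theorem margY_shiftMarg_congr [DecidableEq Y] {P : X → ℝ} {s : X → Y} {c : ℝ} {Q Q' : X → Y → ℝ}
    (hX : margX Q = margX Q') (hY : margY Q = margY Q') :
    margY (shiftMarg P s c Q) = margY (shiftMarg P s c Q') := by
  funext y
  have := congrFun hY y
  simp only [margY] at this
  simp only [margY, shiftMarg, Finset.sum_add_distrib, ← Finset.mul_sum, hX, this]

theorem shiftMarg_nonneg [DecidableEq Y] {P : X → ℝ} {s : X → Y} {c : ℝ} {Q : X → Y → ℝ}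
    (hQ : ∀ x y, 0 ≤ Q x y) (hc : 0 ≤ c) (hcP : ∀ x, c * margX Q x ≤ P x) (x : X) (y : Y) :
    0 ≤ shiftMarg P s c Q x y := by
  unfold shiftMarg
  have := mul_nonneg hc (hQ x y)
  split_ifs
  · linarith [hcP x]
  · linarith

theorem shiftMarg_mem_joints [DecidableEq Y] {P : X → ℝ} (hP : ∑ x, P x = 1) {s : X → Y} {c : ℝ}
    {Q : X → Y → ℝ} (hQ : ∀ x y, 0 ≤ Q x y) (hc : 0 ≤ c) (hcP : ∀ x, c * margX Q x ≤ P x) :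
    shiftMarg P s c Q ∈ joints P := by
  refine ⟨shiftMarg_nonneg hQ hc hcP, ?_, margX_shiftMarg P s c Q⟩
  calc ∑ x, ∑ y, shiftMarg P s c Q x y = ∑ x, margX (shiftMarg P s c Q) x := rfl
    _ = 1 := by rw [margX_shiftMarg, hP]

theorem dominated_shiftMarg [DecidableEq Y] {P : X → ℝ} (hP : ∀ x, 0 ≤ P x) {s : X → Y} {c : ℝ}
    {Q W : X → Y → ℝ} (hQ : ∀ x y, 0 ≤ Q x y) (hc : 0 ≤ c) (hcP : ∀ x, c * margX Q x ≤ P x)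
    (hd : Dominated Q W) (hs : ∀ x, 0 < P x → W x (s x) ≠ 0) :
    Dominated (shiftMarg P s c Q) W := by
  intro x y hw
  unfold shiftMarg
  rw [hd x y hw]
  split_ifs with h
  · subst h
    -- The only dangerous new mass is at `(x, s x)` with `W x (s x) = 0`. There `P x = 0`, and `hcP`
    -- squeezes the missing mass to zero.
    have hP0 : P x = 0 := by
      by_contra hne
      exact hs x (lt_of_le_of_ne (hP x) (Ne.symm hne)) hw
    have h1 := hcP x
    have h2 := mul_nonneg hc (margX_nonneg hQ x)
    have : c * margX Q x = 0 := by linarith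
    rw [this, hP0]; ring
  · ring

theorem dist_shiftMarg_le [DecidableEq Y] {P : X → ℝ} {s : X → Y} {t : ℝ} (ht : 0 ≤ t)
    {Q : X → Y → ℝ} (hQ : ∀ x y, 0 ≤ Q x y) (hQ1 : ∑ x, ∑ y, Q x y = 1) :
    dist Q (shiftMarg P s (1 - t) Q) ≤ 2 * t + dist (margX Q) P := by
  have h0 : 0 ≤ 2 * t + dist (margX Q) P := by positivity
  refine (dist_pi_le_iff h0).2 fun x => (dist_pi_le_iff h0).2 fun y => ?_
  have h1 := (le_one_of_sum hQ hQ1).2 x y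
  have h2 := hQ x y
  have hm0 := margX_nonneg hQ x
  have hm1 : margX Q x ≤ 1 := by
    rw [← hQ1]
    exact Finset.single_le_sum (f := fun x => margX Q x) (fun x _ => margX_nonneg hQ x)
      (Finset.mem_univ x)
  have h3 : |margX Q x - P x| ≤ dist (margX Q) P := dist_le_pi_dist (margX Q) P x
  simp only [Pi.one_apply] at h1
  rw [Real.dist_eq, shiftMarg, abs_le]
  rw [abs_le] at h3
  split_ifs
  · constructor <;> nlinarith [h3.1, h3.2]
  · have : 0 ≤ dist (margX Q) P := dist_nonneg
    constructor <;> nlinarith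

/-- If `P'` is close to `P` and vanishes where `P` does, then `(1 - t) P' ≤ P`. -/
theorem exists_mul_le (P : X → ℝ) (hP : ∀ x, 0 ≤ P x) {t : ℝ} (ht : 0 < t) (ht1 : t ≤ 1) :
    ∃ η > 0, ∀ P' : X → ℝ, (∀ x, P x = 0 → P' x = 0) → dist P' P ≤ η →
      (∀ x, (1 - t) * P' x ≤ P x) ∧ (∀ x, 0 < P x → 0 < P' x) := by
  have : ∀ x, ∃ η > 0, ∀ p : ℝ, (P x = 0 → p = 0) → |p - P x| ≤ η →
      (1 - t) * p ≤ P x ∧ (0 < P x → 0 < p) := by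
    intro x
    rcases (hP x).eq_or_lt with h | h
    · refine ⟨1, one_pos, fun p hp _ => ?_⟩
      rw [hp h.symm, ← h]; simp
    · refine ⟨t * P x / 2, by positivity, fun p _ hp => ?_⟩
      rw [abs_le] at hp
      constructor
      · nlinarith [hp.1, hp.2, mul_pos ht h]
      · intro _
        nlinarith [hp.1, hp.2, mul_pos ht h]
  choose η hη h using this
  obtain ⟨e, he, hle⟩ : ∃ e > 0, ∀ x, e ≤ η x := by
    rcases isEmpty_or_nonempty X with hX | hX
    · exact ⟨1, one_pos, fun x => hX.elim x⟩
    · obtain ⟨x0, hx0⟩ := Finite.exists_min η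
      exact ⟨η x0, hη x0, hx0⟩
  refine ⟨e, he, fun P' h0 hd => ?_⟩
  have key := fun x => h x (P' x) (h0 x) (((dist_le_pi_dist P' P x).trans hd).trans (hle x))
  exact ⟨fun x => (key x).1, fun x => (key x).2⟩

end Compactness

/-! ### Integral rounding of matrices with integral margins. -/

section Rounding

theorem exists_int_sum {ι : Type*} (s : Finset ι) (g : ι → ℝ)
    (h : ∀ i ∈ s, ∃ k : ℤ, (k : ℝ) = g i) : ∃ k : ℤ, (k : ℝ) = ∑ i ∈ s, g i := by
  choose! k hk using h
  exact ⟨∑ i ∈ s, k i, by push_cast; exact Finset.sum_congr rfl hk⟩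

variable {X Y : Type*} [Fintype X] [Fintype Y]

/-- A non-integral matrix with integral row and column sums supports, on its non-integral entries, a
nonzero matrix with vanishing row and column sums. -/
theorem exists_circulation [DecidableEq X] [DecidableEq Y] (B : X → Y → ℝ)
    (hX : ∀ x, ∃ k : ℤ, (k : ℝ) = margX B x) (hY : ∀ y, ∃ k : ℤ, (k : ℝ) = margY B y)
    {x₀ : X} {y₀ : Y} (h₀ : ∀ k : ℤ, (k : ℝ) ≠ B x₀ y₀) :
    ∃ C : X → Y → ℝ, (∃ x y, C x y ≠ 0) ∧ (∀ x y, (∃ k : ℤ, (k : ℝ) = B x y) → C x y = 0) ∧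
      (∀ x, margX C x = 0) ∧ ∀ y, margY C y = 0 := by
  classical
  set F : Finset (X × Y) := Finset.univ.filter fun e => ∀ k : ℤ, (k : ℝ) ≠ B e.1 e.2 with hF
  have memF : ∀ x y, (x, y) ∈ F ↔ ∀ k : ℤ, (k : ℝ) ≠ B x y := fun x y => by simp [hF]
  -- An integral sum cannot have exactly one non-integral term, so each line that meets `F` meets it
  -- at least twice.
  have row : ∀ x y, (x, y) ∈ F → ∃ y', y' ≠ y ∧ (x, y') ∈ F := by
    intro x y hxy
    by_contra! hcon
    obtain ⟨k, hk⟩ := exists_int_sum (Finset.univ.erase y) (fun y' => B x y') fun y' hy' => by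
      have := hcon y' (Finset.ne_of_mem_erase hy')
      rw [memF] at this
      push Not at this
      exact this
    obtain ⟨l, hl⟩ := hX x
    refine (memF x y).1 hxy (l - k) ?_
    have := Finset.add_sum_erase Finset.univ (fun y' => B x y') (Finset.mem_univ y)
    push_cast
    rw [hk, hl, margX, ← this]; ring
  have col : ∀ x y, (x, y) ∈ F → ∃ x', x' ≠ x ∧ (x', y) ∈ F := by
    intro x y hxy
    by_contra! hcon
    obtain ⟨k, hk⟩ := exists_int_sum (Finset.univ.erase x) (fun x' => B x' y) fun x' hx' => by
      have := hcon x' (Finset.ne_of_mem_erase hx')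
      rw [memF] at this
      push Not at this
      exact this
    obtain ⟨l, hl⟩ := hY y
    refine (memF x y).1 hxy (l - k) ?_
    have := Finset.add_sum_erase Finset.univ (fun x' => B x' y) (Finset.mem_univ x)
    push_cast
    rw [hk, hl, margY, ← this]; ring
  have cardr : 2 * (F.image Prod.fst).card ≤ F.card := by
    rw [Finset.card_eq_sum_card_image Prod.fst F, mul_comm, ← smul_eq_mul]
    refine Finset.card_nsmul_le_sum _ _ _ fun x hx => ?_
    obtain ⟨⟨x', y⟩, he, rfl⟩ := Finset.mem_image.1 hx
    obtain ⟨y', hne, hy'⟩ := row x' y he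
    exact Finset.one_lt_card.2 ⟨(x', y'), by simp [hy'], (x', y), by simp [he], by simp [hne]⟩
  have cardc : 2 * (F.image Prod.snd).card ≤ F.card := by
    rw [Finset.card_eq_sum_card_image Prod.snd F, mul_comm, ← smul_eq_mul]
    refine Finset.card_nsmul_le_sum _ _ _ fun y hy => ?_
    obtain ⟨⟨x, y'⟩, he, rfl⟩ := Finset.mem_image.1 hy
    obtain ⟨x', hne, hx'⟩ := col x y' he
    exact Finset.one_lt_card.2 ⟨(x', y'), by simp [hx'], (x, y'), by simp [he], by simp [hne]⟩
  have hy₀ : y₀ ∈ F.image Prod.snd :=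
    Finset.mem_image.2 ⟨(x₀, y₀), (memF _ _).2 h₀, rfl⟩
  -- Dimension count: occupied rows and occupied columns together number at most `F.card`. The
  -- equation of column `y₀` is dropped, since the row equations and the other columns imply it.
  -- That saves one equation, so the kernel is nontrivial.
  let L : (X × Y → ℝ) →ₗ[ℝ] (↥Fᶜ → ℝ) × (↥(F.image Prod.fst) → ℝ) ×
      (↥((F.image Prod.snd).erase y₀) → ℝ) :=
    { toFun := fun f => (fun e => f e.1, fun x => ∑ y, f (x.1, y), fun y => ∑ x, f (x, y.1))
      map_add' := fun f g => by
        simp only [Pi.add_apply, Finset.sum_add_distrib]; rfl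
      map_smul' := fun c f => by
        simp only [Pi.smul_apply, smul_eq_mul, ← Finset.mul_sum]; rfl }
  have hker : LinearMap.ker L ≠ ⊥ := by
    apply LinearMap.ker_ne_bot_of_finrank_lt
    simp only [Module.finrank_prod, Module.finrank_fintype_fun_eq_card, Fintype.card_coe,
      Finset.card_compl, Finset.card_erase_of_mem hy₀]
    have h1 : F.card ≤ Fintype.card (X × Y) := Finset.card_le_univ F
    have h2 : 0 < (F.image Prod.snd).card := Finset.card_pos.2 ⟨_, hy₀⟩
    omega
  obtain ⟨f, hf, hf0⟩ := (Submodule.ne_bot_iff _).1 hker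
  rw [LinearMap.mem_ker] at hf
  have hf1 : ∀ e, e ∉ F → f e = 0 := fun e he =>
    congrFun (congrArg Prod.fst hf) ⟨e, by simpa using he⟩
  have hrow : ∀ x, ∑ y, f (x, y) = 0 := by
    intro x
    by_cases hx : x ∈ F.image Prod.fst
    · exact congrFun (congrArg (fun p => p.2.1) hf) ⟨x, hx⟩
    · exact Finset.sum_eq_zero fun y _ => hf1 _ fun he => hx (Finset.mem_image_of_mem Prod.fst he)
  have hcol' : ∀ y, y ≠ y₀ → ∑ x, f (x, y) = 0 := by
    intro y hne
    by_cases hy : y ∈ F.image Prod.snd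
    · exact congrFun (congrArg (fun p => p.2.2) hf) ⟨y, Finset.mem_erase.2 ⟨hne, hy⟩⟩
    · exact Finset.sum_eq_zero fun x _ => hf1 _ fun he => hy (Finset.mem_image_of_mem Prod.snd he)
  have hcol : ∀ y, ∑ x, f (x, y) = 0 := by
    intro y
    by_cases hne : y = y₀
    · have h1 : ∑ y, ∑ x, f (x, y) = 0 := by
        rw [Finset.sum_comm]; exact Finset.sum_eq_zero fun x _ => hrow x
      rw [Finset.sum_eq_single y₀ (fun y _ h => hcol' y h) (by simp)] at h1
      rw [hne, h1]
    · exact hcol' y hne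
  refine ⟨fun x y => f (x, y), ?_, fun x y hk => hf1 _ fun he => ?_, hrow, hcol⟩
  · by_contra! h
    exact hf0 (funext fun e => h e.1 e.2)
  · obtain ⟨k, hk⟩ := hk
    exact (memF x y).1 he k hk

/-- Induction on the number of non-integral entries. Moving along a circulation supported on these
entries preserves the margins, and the move stops when a first entry reaches its floor or ceiling.
No integral entry is disturbed and at least one more becomes integral. -/
theorem exists_int_matrix_aux [DecidableEq X] [DecidableEq Y] (m : ℕ) : ∀ B : X → Y → ℝ,
    (∀ x, ∃ k : ℤ, (k : ℝ) = margX B x) → (∀ y, ∃ k : ℤ, (k : ℝ) = margY B y) →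
    Set.ncard {e : X × Y | ∀ k : ℤ, (k : ℝ) ≠ B e.1 e.2} = m →
    ∃ N : X → Y → ℤ, (∀ x y, ⌊B x y⌋ ≤ N x y ∧ N x y ≤ ⌈B x y⌉) ∧
      (∀ x, ∑ y, (N x y : ℝ) = margX B x) ∧ ∀ y, ∑ x, (N x y : ℝ) = margY B y := by
  induction m using Nat.strong_induction_on with
  | _ m ih =>
  intro B hX hY hm
  by_cases hint : ∀ x y, ∃ k : ℤ, (k : ℝ) = B x y
  · choose N hN using hint
    refine ⟨N, fun x y => ?_, fun x => ?_, fun y => ?_⟩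
    · rw [← hN]; simp
    · simp only [hN]; rfl
    · simp only [hN]; rfl
  push Not at hint
  obtain ⟨x₀, y₀, h₀⟩ := hint
  obtain ⟨C, ⟨x₁, y₁, hC₁⟩, hCi, hCX, hCY⟩ := exists_circulation B hX hY h₀
  -- the largest admissible step in the direction `C`
  let r : X × Y → ℝ := fun e =>
    if 0 < C e.1 e.2 then ((⌈B e.1 e.2⌉ : ℝ) - B e.1 e.2) / C e.1 e.2
    else ((⌊B e.1 e.2⌋ : ℝ) - B e.1 e.2) / C e.1 e.2
  obtain ⟨e, heC, hmin⟩ : ∃ e : X × Y, C e.1 e.2 ≠ 0 ∧ ∀ e', C e'.1 e'.2 ≠ 0 → r e ≤ r e' := by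
    obtain ⟨e, he, hmin⟩ := Set.exists_min_image {e : X × Y | C e.1 e.2 ≠ 0} r (Set.toFinite _)
      ⟨(x₁, y₁), hC₁⟩
    exact ⟨e, he, hmin⟩
  have hr0 : 0 ≤ r e := by
    simp only [r]
    split_ifs with h
    · exact div_nonneg (sub_nonneg.2 (Int.le_ceil _)) h.le
    · exact div_nonneg_of_nonpos (sub_nonpos.2 (Int.floor_le _)) (not_lt.1 h)
  set B' : X → Y → ℝ := fun x y => B x y + r e * C x y with hB'
  have hbd : ∀ x y, (⌊B x y⌋ : ℝ) ≤ B' x y ∧ B' x y ≤ ⌈B x y⌉ := by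
    intro x y
    have hfl := Int.floor_le (B x y)
    have hce := Int.le_ceil (B x y)
    rcases lt_trichotomy (C x y) 0 with hc | hc | hc
    · have h1 := hmin (x, y) hc.ne
      have h2 : r (x, y) = ((⌊B x y⌋ : ℝ) - B x y) / C x y := by simp [r, not_lt.2 hc.le]
      rw [h2, le_div_iff_of_neg hc] at h1
      constructor
      · simp only [hB']; linarith
      · simp only [hB']; nlinarith
    · simp only [hB', hc]; constructor <;> linarith
    · have h1 := hmin (x, y) hc.ne'
      have h2 : r (x, y) = ((⌈B x y⌉ : ℝ) - B x y) / C x y := by simp [r, hc]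
      rw [h2, le_div_iff₀ hc] at h1
      constructor
      · simp only [hB']; nlinarith
      · simp only [hB']; linarith
  have hmX : margX B' = margX B := by
    funext x
    have := hCX x
    simp only [margX] at this
    simp [hB', margX, Finset.sum_add_distrib, ← Finset.mul_sum, this]
  have hmY : margY B' = margY B := by
    funext y
    have := hCY y
    simp only [margY] at this
    simp [hB', margY, Finset.sum_add_distrib, ← Finset.mul_sum, this]
  have hlt : Set.ncard {e : X × Y | ∀ k : ℤ, (k : ℝ) ≠ B' e.1 e.2} < m := by
    rw [← hm]
    refine Set.ncard_lt_ncard ⟨fun e' he' k hk => ?_, fun hsub => ?_⟩ (Set.toFinite _)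
    · refine he' k ?_
      simp only [hB', hCi _ _ ⟨k, hk⟩, hk]; ring
    · have hefr : e ∈ {e : X × Y | ∀ k : ℤ, (k : ℝ) ≠ B e.1 e.2} := by
        intro k hk
        exact heC (hCi _ _ ⟨k, hk⟩)
      have hno := hsub hefr
      by_cases hc : 0 < C e.1 e.2
      · refine hno ⌈B e.1 e.2⌉ ?_
        simp only [hB', r, if_pos hc]
        field_simp; ring
      · refine hno ⌊B e.1 e.2⌋ ?_
        simp only [hB', r, if_neg hc]
        field_simp; ring
  obtain ⟨N, hN, hNX, hNY⟩ := ih _ hlt B' (by rwa [hmX]) (by rwa [hmY]) rfl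
  refine ⟨N, fun x y => ⟨?_, ?_⟩, by rwa [hmX] at hNX, by rwa [hmY] at hNY⟩
  · exact (Int.le_floor.2 (hbd x y).1).trans (hN x y).1
  · exact (hN x y).2.trans (Int.ceil_le.2 (hbd x y).2)

/-- A nonnegative matrix with integral row and column sums can be rounded to a matrix of natural
numbers with the same row and column sums. -/
theorem exists_nat_matrix (B : X → Y → ℝ) (hB : ∀ x y, 0 ≤ B x y)
    (hX : ∀ x, ∃ k : ℕ, (k : ℝ) = margX B x) (hY : ∀ y, ∃ k : ℕ, (k : ℝ) = margY B y) :
    ∃ N : X → Y → ℕ, (∀ x y, |(N x y : ℝ) - B x y| ≤ 1) ∧ (∀ x y, B x y = 0 → N x y = 0) ∧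
      (∀ x, ∑ y, (N x y : ℝ) = margX B x) ∧ ∀ y, ∑ x, (N x y : ℝ) = margY B y := by
  classical
  obtain ⟨N, hN, hNX, hNY⟩ := exists_int_matrix_aux _ B
    (fun x => (hX x).imp' (fun k : ℕ => (k : ℤ)) fun k hk => by simpa using hk)
    (fun y => (hY y).imp' (fun k : ℕ => (k : ℤ)) fun k hk => by simpa using hk) rfl
  have hN0 : ∀ x y, 0 ≤ N x y := fun x y => (Int.floor_nonneg.2 (hB x y)).trans (hN x y).1
  have hcast : ∀ x y, (((N x y).toNat : ℕ) : ℝ) = (N x y : ℝ) := fun x y => by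
    rw [← Int.cast_natCast, Int.toNat_of_nonneg (hN0 x y)]
  refine ⟨fun x y => (N x y).toNat, fun x y => ?_, fun x y h0 => ?_, fun x => ?_, fun y => ?_⟩
  · rw [hcast, abs_le]
    have h1 : (⌊B x y⌋ : ℝ) ≤ N x y := by exact_mod_cast (hN x y).1
    have h2 : (N x y : ℝ) ≤ ⌈B x y⌉ := by exact_mod_cast (hN x y).2
    have h3 := Int.lt_floor_add_one (B x y)
    have h4 := Int.ceil_lt_add_one (B x y)
    constructor <;> linarith
  · have := (hN x y).2
    rw [h0, Int.ceil_zero] at this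
    simp [this]
  · simp only [hcast]; exact hNX x
  · simp only [hcast]; exact hNY y

end Rounding

/-! ### Exact counting of type classes and conditional type classes. -/

section Counting

/-- The number of occurrences of `z` in the word `f`. -/
def cnt {Z : Type*} [DecidableEq Z] {n : ℕ} (f : Fin n → Z) (z : Z) : ℕ :=
  (Finset.univ.filter fun i => f i = z).card

/-- The word of pairs formed by two words. -/
def pair {X Y : Type*} {n : ℕ} (x : Fin n → X) (y : Fin n → Y) (i : Fin n) : X × Y := (x i, y i)

section OneWord

variable {Z : Type*} [Fintype Z] [DecidableEq Z] {n : ℕ}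

theorem cnt_le (f : Fin n → Z) (z : Z) : cnt f z ≤ n :=
  (Finset.card_filter_le _ _).trans (by simp)

theorem cnt_apply_pos (f : Fin n → Z) (i : Fin n) : 0 < cnt f (f i) :=
  Finset.card_pos.2 ⟨i, by simp⟩

theorem exists_of_cnt_ne_zero {f : Fin n → Z} {z : Z} (h : cnt f z ≠ 0) : ∃ i, f i = z := by
  obtain ⟨i, hi⟩ := Finset.card_pos.1 (Nat.pos_of_ne_zero h)
  exact ⟨i, by simpa using hi⟩

theorem sum_apply_eq (f : Fin n → Z) (g : Z → ℝ) : ∑ i, g (f i) = ∑ z, (cnt f z : ℝ) * g z := by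
  have : ∀ z, (cnt f z : ℝ) * g z = ∑ i, if f i = z then g z else 0 := fun z => by
    rw [← Finset.sum_filter, Finset.sum_const, nsmul_eq_mul]; rfl
  simp only [this]
  rw [Finset.sum_comm]
  exact Finset.sum_congr rfl fun i _ => by simp

theorem sum_cnt (f : Fin n → Z) : ∑ z, cnt f z = n := by
  have := sum_apply_eq f fun _ => 1
  simp only [Finset.sum_const, Finset.card_univ, Fintype.card_fin, nsmul_eq_mul, mul_one] at this
  exact_mod_cast this.symm

theorem card_subtype_eq_cnt (f : Fin n → Z) (z : Z) : Fintype.card {i // f i = z} = cnt f z :=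
  Fintype.card_subtype _

theorem exists_perm_of_cnt_eq {f g : Fin n → Z} (h : ∀ z, cnt f z = cnt g z) :
    ∃ σ : Equiv.Perm (Fin n), f ∘ σ = g := by
  have e : ∀ z, {i // g i = z} ≃ {i // f i = z} := fun z =>
    Fintype.equivOfCardEq (by rw [card_subtype_eq_cnt, card_subtype_eq_cnt, h])
  refine ⟨(Equiv.sigmaFiberEquiv g).symm.trans
    ((Equiv.sigmaCongrRight e).trans (Equiv.sigmaFiberEquiv f)), ?_⟩
  funext i
  exact (e (g i) ⟨i, rfl⟩).2

theorem cnt_comp_perm (f : Fin n → Z) (σ : Equiv.Perm (Fin n)) (z : Z) :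
    cnt (f ∘ σ) z = cnt f z := by
  rw [← card_subtype_eq_cnt, ← card_subtype_eq_cnt]
  exact Fintype.card_congr (σ.subtypeEquiv fun i => Iff.rfl)

/-- The permutations carrying `f` to `g` form a coset of the stabilizer of `f`, which permutes each
fibre of `f` independently. -/
theorem card_perm_comp_eq {f g : Fin n → Z} (h : ∀ z, cnt f z = cnt g z) :
    (Finset.univ.filter fun σ : Equiv.Perm (Fin n) => f ∘ σ = g).card = ∏ z, (cnt f z).factorial := by
  obtain ⟨τ, hτ⟩ := exists_perm_of_cnt_eq h
  have h1 := DomMulAct.stabilizer_card f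
  simp only [card_subtype_eq_cnt] at h1
  rw [← h1, Fintype.card_subtype]
  refine Finset.card_bij (fun σ _ => σ * τ⁻¹) ?_ ?_ ?_
  · intro σ hσ
    simp only [Finset.mem_filter, Finset.mem_univ, true_and] at hσ ⊢
    funext i
    have := congrFun hσ (τ⁻¹ i)
    simp only [Function.comp_apply] at this
    rw [Function.comp_apply, Equiv.Perm.mul_apply, this, ← hτ]
    simp
  · intro σ _ σ' _ h
    exact mul_right_cancel h
  · intro ρ hρ
    simp only [Finset.mem_filter, Finset.mem_univ, true_and] at hρ
    refine ⟨ρ * τ, ?_, by simp⟩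
    simp only [Finset.mem_filter, Finset.mem_univ, true_and]
    rw [← hτ]
    funext i
    exact congrFun hρ (τ i)

/-- The words with the same type as `f`. -/
def typeClass (f : Fin n → Z) : Finset (Fin n → Z) := Finset.univ.filter fun g => cnt g = cnt f

theorem mem_typeClass {f g : Fin n → Z} : g ∈ typeClass f ↔ cnt g = cnt f := by
  simp [typeClass]

end OneWord

section TwoWords

variable {X Y : Type*} [Fintype X] [Fintype Y] [DecidableEq X] [DecidableEq Y] {n : ℕ}

theorem sum_cnt_pair_right (x : Fin n → X) (y : Fin n → Y) (a : X) :
    ∑ b, cnt (pair x y) (a, b) = cnt x a := by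
  have h : ∀ b ∈ (Finset.univ : Finset Y), cnt (pair x y) (a, b) =
      ((Finset.univ.filter fun i => x i = a).filter fun i => y i = b).card := fun b _ => by
    simp [cnt, pair, Finset.filter_filter]
  rw [Finset.sum_congr rfl h, cnt]
  exact (Finset.card_eq_sum_card_fiberwise fun i _ => by simp).symm

theorem sum_cnt_pair_left (x : Fin n → X) (y : Fin n → Y) (b : Y) :
    ∑ a, cnt (pair x y) (a, b) = cnt y b := by
  have h : ∀ a ∈ (Finset.univ : Finset X), cnt (pair x y) (a, b) =
      ((Finset.univ.filter fun i => y i = b).filter fun i => x i = a).card := fun a _ => by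
    simp [cnt, pair, Finset.filter_filter, and_comm]
  rw [Finset.sum_congr rfl h, cnt]
  exact (Finset.card_eq_sum_card_fiberwise fun i _ => by simp).symm

/-- Orbit counting for the stabilizer of `y`. It acts transitively on the words that have the joint
type of `x` with `y`, and each such word arises from as many permutations as stabilize the pair `(x,
y)`. -/
theorem card_condClass_mul (x : Fin n → X) (y : Fin n → Y) :
    (Finset.univ.filter fun x' => cnt (pair x' y) = cnt (pair x y)).card *
      ∏ z, (cnt (pair x y) z).factorial = ∏ b, (cnt y b).factorial := by
  rw [← card_perm_comp_eq (f := y) (g := y) fun _ => rfl,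
    Finset.card_eq_sum_card_fiberwise (f := fun σ : Equiv.Perm (Fin n) => x ∘ σ)
      (t := Finset.univ.filter fun x' => cnt (pair x' y) = cnt (pair x y)), Finset.sum_const_nat]
  · intro x' hx'
    simp only [Finset.mem_filter, Finset.mem_univ, true_and] at hx'
    rw [← card_perm_comp_eq (f := pair x y) (g := pair x' y) fun z => (congrFun hx' z).symm,
      Finset.filter_filter]
    congr 1
    ext σ
    simp only [Finset.mem_filter, Finset.mem_univ, true_and, funext_iff, pair, Function.comp_apply,
      Prod.mk.injEq, forall_and]
    exact and_comm
  · intro σ hσ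
    simp only [Finset.coe_filter, Finset.mem_univ, true_and, Set.mem_ofPred_eq] at hσ ⊢
    funext z
    have : pair (x ∘ σ) y = pair x y ∘ σ := by
      funext i
      simp only [pair, Function.comp_apply, Prod.mk.injEq, true_and]
      exact (congrFun hσ i).symm
    rw [this, cnt_comp_perm]

/-- The multinomial formula, obtained as the conditional count over a one-letter output alphabet. -/
theorem card_typeClass_mul (x : Fin n → X) :
    (typeClass x).card * ∏ a, (cnt x a).factorial = n.factorial := by
  have h := card_condClass_mul x fun _ : Fin n => ()
  have hc : ∀ x' : Fin n → X, ∀ a u, cnt (pair x' fun _ => ()) (a, u) = cnt x' a := fun x' a u => by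
    simp [cnt, pair]
  rw [Fintype.prod_prod_type] at h
  simp only [hc, Finset.univ_unique, Finset.prod_singleton] at h
  have h1 : cnt (fun _ : Fin n => ()) default = n := by simp [cnt]
  rw [h1] at h
  rw [← h, typeClass]
  congr 2
  ext x'
  simp only [Finset.mem_filter, Finset.mem_univ, true_and]
  constructor
  · intro h'
    funext ⟨a, u⟩
    rw [hc, hc, h']
  · intro h'
    funext a
    have := congrFun h' (a, ())
    rwa [hc, hc] at this

/-- The positions where `y` equals `b` are as many as the elements of `Σ a, Fin (N a b)`. Any
bijection assigns to each position a letter `a` with the right multiplicity. -/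
theorem exists_word_of_cnt (y : Fin n → Y) (N : X → Y → ℕ) (hN : ∀ b, ∑ a, N a b = cnt y b) :
    ∃ x : Fin n → X, ∀ a b, cnt (pair x y) (a, b) = N a b := by
  have e : ∀ b, {i // y i = b} ≃ Σ a, Fin (N a b) := fun b =>
    Fintype.equivOfCardEq (by
      rw [card_subtype_eq_cnt, Fintype.card_sigma]; simp [hN])
  refine ⟨fun i => (e (y i) ⟨i, rfl⟩).1, fun a b => ?_⟩
  have hx : ∀ b (i : {i // y i = b}), (e (y i) ⟨i, rfl⟩).1 = (e b i).1 := by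
    rintro b ⟨i, rfl⟩; rfl
  rw [← card_subtype_eq_cnt]
  have e1 : {i // pair (fun i => (e (y i) ⟨i, rfl⟩).1) y i = (a, b)} ≃
      {j : {i // y i = b} // (e b j).1 = a} :=
    { toFun := fun i => ⟨⟨i.1, (Prod.ext_iff.1 i.2).2⟩,
        (hx b ⟨i.1, (Prod.ext_iff.1 i.2).2⟩).symm.trans (Prod.ext_iff.1 i.2).1⟩
      invFun := fun j => ⟨j.1.1, Prod.ext ((hx b j.1).trans j.2) j.1.2⟩
      left_inv := fun i => rfl
      right_inv := fun j => rfl }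
  have e2 : {j : {i // y i = b} // (e b j).1 = a} ≃ {s : Σ a, Fin (N a b) // s.1 = a} :=
    (e b).subtypeEquiv fun j => Iff.rfl
  have e3 : {s : Σ a, Fin (N a b) // s.1 = a} ≃ Fin (N a b) := Equiv.sigmaSubtype a
  rw [Fintype.card_congr ((e1.trans e2).trans e3), Fintype.card_fin]

/-- The logarithm of the probability of a word under its own conditional type. -/
def selfLog (x : Fin n → X) (y : Fin n → Y) : ℝ :=
  ∑ a, ∑ b, (cnt (pair x y) (a, b) : ℝ) * Real.log (cnt (pair x y) (a, b))
    - ∑ b, (cnt y b : ℝ) * Real.log (cnt y b)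

theorem exp_selfLog (x : Fin n → X) (y : Fin n → Y) :
    Real.exp (selfLog x y) = ∏ i, ((cnt (pair x y) (x i, y i) : ℝ) /
      ∑ a, (cnt (pair x y) (a, y i) : ℝ)) := by
  have hpos : ∀ i, (0 : ℝ) < cnt (pair x y) (x i, y i) := fun i => by
    exact_mod_cast cnt_apply_pos (pair x y) i
  have hpos' : ∀ i, (0 : ℝ) < ∑ a, (cnt (pair x y) (a, y i) : ℝ) := fun i =>
    (hpos i).trans_le (Finset.single_le_sum (f := fun a => (cnt (pair x y) (a, y i) : ℝ))
      (fun _ _ => Nat.cast_nonneg _) (Finset.mem_univ (x i)))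
  rw [← Real.exp_log (Finset.prod_pos fun i _ => div_pos (hpos i) (hpos' i)),
    Real.log_prod fun i _ => (div_pos (hpos i) (hpos' i)).ne']
  congr 1
  have h := sum_apply_eq (pair x y) fun z => Real.log ((cnt (pair x y) z : ℝ) /
      ∑ a, (cnt (pair x y) (a, z.2) : ℝ))
  simp only [pair] at h
  rw [h, Fintype.sum_prod_type, selfLog]
  have h2 : ∑ b, (cnt y b : ℝ) * Real.log (cnt y b)
      = ∑ a, ∑ b, (cnt (pair x y) (a, b) : ℝ) * Real.log (cnt y b) := by
    rw [Finset.sum_comm]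
    refine Finset.sum_congr rfl fun b _ => ?_
    rw [← Finset.sum_mul, ← sum_cnt_pair_left x y b]; push_cast; rfl
  rw [h2, ← Finset.sum_sub_distrib]
  refine Finset.sum_congr rfl fun a _ => ?_
  rw [← Finset.sum_sub_distrib]
  refine Finset.sum_congr rfl fun b _ => ?_
  have h3 : ∑ a', (cnt (pair x y) (a', b) : ℝ) = cnt y b := by
    rw [← sum_cnt_pair_left x y b]; push_cast; rfl
  rw [h3]
  rcases Nat.eq_zero_or_pos (cnt (pair x y) (a, b)) with h0 | h0
  · rw [h0]; simp
  · have h4 : cnt (pair x y) (a, b) ≤ cnt y b := by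
      rw [← sum_cnt_pair_left x y b]
      exact Finset.single_le_sum (f := fun a => cnt (pair x y) (a, b)) (fun _ _ => Nat.zero_le _)
        (Finset.mem_univ a)
    have h5 : (0 : ℝ) < cnt (pair x y) (a, b) := by exact_mod_cast h0
    have h6 : (0 : ℝ) < cnt y b := by exact_mod_cast h0.trans_le h4
    rw [Real.log_div h5.ne' h6.ne']; ring

/-- Summing the probability of each word under its own conditional type gives at most the number of
joint types. -/
theorem sum_exp_selfLog_le (y : Fin n → Y) :
    ∑ x : Fin n → X, Real.exp (selfLog x y)
      ≤ ((n : ℝ) + 1) ^ (Fintype.card X * Fintype.card Y) := by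
  let w : (X × Y → Fin (n + 1)) → X → Y → ℝ := fun t a b =>
    ((t (a, b) : ℕ) : ℝ) / ∑ a', ((t (a', b) : ℕ) : ℝ)
  have hw0 : ∀ t a b, 0 ≤ w t a b := fun t a b => by positivity
  have hw1 : ∀ t b, ∑ a, w t a b ≤ 1 := fun t b => by
    simp only [w]
    rw [← Finset.sum_div]
    -- The inequality cannot be an equality in general: an empty column has sum `0 / 0 = 0`.
    exact div_self_le_one _
  have hle : ∀ x : Fin n → X, Real.exp (selfLog x y) ≤ ∑ t, ∏ i, w t (x i) (y i) := by
    intro x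
    let t : X × Y → Fin (n + 1) := fun z => ⟨cnt (pair x y) z, Nat.lt_succ_of_le (cnt_le _ _)⟩
    have : Real.exp (selfLog x y) = ∏ i, w t (x i) (y i) := exp_selfLog x y
    rw [this]
    exact Finset.single_le_sum (f := fun t => ∏ i, w t (x i) (y i))
      (fun t _ => Finset.prod_nonneg fun i _ => hw0 _ _ _) (Finset.mem_univ t)
  calc ∑ x : Fin n → X, Real.exp (selfLog x y)
      ≤ ∑ x : Fin n → X, ∑ t, ∏ i, w t (x i) (y i) := Finset.sum_le_sum fun x _ => hle x
    _ = ∑ t, ∑ x : Fin n → X, ∏ i, w t (x i) (y i) := Finset.sum_comm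
    _ ≤ ∑ t : X × Y → Fin (n + 1), (1 : ℝ) := by
        refine Finset.sum_le_sum fun t _ => ?_
        have := Finset.prod_univ_sum (fun _ : Fin n => (Finset.univ : Finset X))
          fun i a => w t a (y i)
        rw [Fintype.piFinset_univ] at this
        rw [← this]
        exact Finset.prod_le_one (fun i _ => Finset.sum_nonneg fun a _ => hw0 _ _ _)
          fun i _ => hw1 _ _
    _ = _ := by simp

theorem cnt_pair_swap (x : Fin n → X) (y : Fin n → Y) (a : X) (b : Y) :
    cnt (pair y x) (b, a) = cnt (pair x y) (a, b) := by
  simp only [cnt, pair, Prod.mk.injEq, and_comm]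

end TwoWords

end Counting

/-! ### Stirling bounds and the exponential estimates of the method of types. -/

section TypeEstimates

theorem le_log_factorial (k : ℕ) :
    (k : ℝ) * Real.log k - k ≤ Real.log (k.factorial : ℝ) := by
  induction k with
  | zero => simp
  | succ k ih =>
    rw [Nat.factorial_succ, Nat.cast_mul, Real.log_mul (by positivity) (by positivity)]
    rcases Nat.eq_zero_or_pos k with h | h
    · subst h; simp
    have hk : (0 : ℝ) < k := by exact_mod_cast h
    have h1 : Real.log ((k + 1 : ℕ) : ℝ) - Real.log k ≤ 1 / k := by
      rw [← Real.log_div (by positivity) hk.ne']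
      refine (Real.log_le_sub_one_of_pos (by positivity)).trans (le_of_eq ?_)
      push_cast; field_simp; ring
    have h2 : (k : ℝ) * (Real.log ((k + 1 : ℕ) : ℝ) - Real.log k) ≤ 1 := by
      calc _ ≤ (k : ℝ) * (1 / k) := by gcongr
        _ = 1 := by field_simp
    push_cast at h2 ⊢
    nlinarith

theorem log_factorial_le (k : ℕ) :
    Real.log (k.factorial : ℝ) ≤ (k : ℝ) * Real.log k - k + (1 + Real.log ((k : ℝ) + 1)) := by
  -- The index is shifted by one so that no logarithm of zero occurs. The induction step amounts to
  -- `1 / (k + 2) ≤ log ((k + 2) / (k + 1))`.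
  have key : ∀ k : ℕ, Real.log ((k + 1).factorial : ℝ)
      ≤ ((k : ℝ) + 2) * Real.log ((k : ℝ) + 1) - k := by
    intro k
    induction k with
    | zero => simp
    | succ k ih =>
      rw [Nat.factorial_succ, Nat.cast_mul, Real.log_mul (by positivity) (by positivity)]
      have hk : (0 : ℝ) < (k : ℝ) + 1 := by positivity
      have h1 : 1 / ((k : ℝ) + 2) ≤ Real.log ((k : ℝ) + 2) - Real.log ((k : ℝ) + 1) := by
        rw [← Real.log_div (by positivity) hk.ne']
        refine le_trans (le_of_eq ?_) (Real.one_sub_inv_le_log_of_pos (by positivity))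
        field_simp; ring
      have h2 : 1 ≤ ((k : ℝ) + 2) * (Real.log ((k : ℝ) + 2) - Real.log ((k : ℝ) + 1)) := by
        calc (1 : ℝ) = ((k : ℝ) + 2) * (1 / ((k : ℝ) + 2)) := by field_simp
          _ ≤ _ := by gcongr
      have e : ((k : ℝ) + 1 + 1) = (k : ℝ) + 2 := by ring
      push_cast at ih ⊢
      rw [e]
      nlinarith
  cases k with
  | zero => simp
  | succ k =>
    refine (key k).trans ?_
    have : Real.log ((k : ℝ) + 1) ≤ Real.log ((k : ℝ) + 1 + 1) :=
      Real.log_le_log (by positivity) (by linarith)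
    push_cast
    nlinarith

/-- The loss of Stirling's formula for factorials of numbers up to `n`. -/
def stirlingLoss (n : ℕ) : ℝ := 1 + Real.log ((n : ℝ) + 1)

theorem stirlingLoss_nonneg (n : ℕ) : 0 ≤ stirlingLoss n := by
  have : 0 ≤ Real.log ((n : ℝ) + 1) := Real.log_nonneg (by simp)
  unfold stirlingLoss; linarith

theorem log_factorial_le_of_le {k n : ℕ} (h : k ≤ n) :
    Real.log (k.factorial : ℝ) ≤ (k : ℝ) * Real.log k - k + stirlingLoss n := by
  refine (log_factorial_le k).trans ?_
  have : Real.log ((k : ℝ) + 1) ≤ Real.log ((n : ℝ) + 1) :=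
    Real.log_le_log (by positivity) (by gcongr)
  unfold stirlingLoss; linarith

variable {X Y : Type*} [Fintype X] [Fintype Y] [DecidableEq X] [DecidableEq Y] {n : ℕ}

/-- The joint type of two words. -/
def typ (x : Fin n → X) (y : Fin n → Y) (a : X) (b : Y) : ℝ := (cnt (pair x y) (a, b) : ℝ) / n

theorem typ_nonneg (x : Fin n → X) (y : Fin n → Y) (a : X) (b : Y) : 0 ≤ typ x y a b := by
  unfold typ; positivity

theorem margX_typ (x : Fin n → X) (y : Fin n → Y) (a : X) :
    margX (typ x y) a = (cnt x a : ℝ) / n := by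
  rw [margX, ← sum_cnt_pair_right x y a]
  push_cast
  rw [Finset.sum_div]; rfl

theorem margY_typ (x : Fin n → X) (y : Fin n → Y) (b : Y) :
    margY (typ x y) b = (cnt y b : ℝ) / n := by
  rw [margY, ← sum_cnt_pair_left x y b]
  push_cast
  rw [Finset.sum_div]; rfl

theorem sum_typ (hn : 0 < n) (x : Fin n → X) (y : Fin n → Y) : ∑ a, ∑ b, typ x y a b = 1 := by
  have : ∑ a, ∑ b, typ x y a b = ∑ a, margX (typ x y) a := rfl
  rw [this]
  simp only [margX_typ]
  rw [← Finset.sum_div, ← Nat.cast_sum, sum_cnt, div_self]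
  positivity

theorem mul_linLog_typ (hn : 0 < n) (W : X → Y → ℝ) (x : Fin n → X) (y : Fin n → Y) :
    n * linLog W (typ x y) = ∑ i, Real.log (W (x i) (y i)) := by
  have hn' : (n : ℝ) ≠ 0 := by positivity
  have h := sum_apply_eq (pair x y) fun z => Real.log (W z.1 z.2)
  simp only [pair] at h
  rw [h, Fintype.sum_prod_type, linLog, Finset.mul_sum]
  refine Finset.sum_congr rfl fun a _ => ?_
  rw [Finset.mul_sum]
  refine Finset.sum_congr rfl fun b _ => ?_
  rw [typ]; field_simp

theorem dominated_typ_of_blockProb_ne_zero {W : X → Y → ℝ} {x : Fin n → X} {y : Fin n → Y}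
    (h : blockProb W x y ≠ 0) : Dominated (typ x y) W := by
  intro a b hw
  by_contra hne
  have : cnt (pair x y) (a, b) ≠ 0 := fun h0 => hne (by simp [typ, h0])
  obtain ⟨i, hi⟩ := exists_of_cnt_ne_zero this
  simp only [pair, Prod.mk.injEq] at hi
  exact h (Finset.prod_eq_zero (Finset.mem_univ i) (by rw [hi.1, hi.2, hw]))

theorem blockProb_eq_exp (hn : 0 < n) {W : X → Y → ℝ} (hW : ∀ a b, 0 ≤ W a b) {x : Fin n → X}
    {y : Fin n → Y} (h : Dominated (typ x y) W) :
    blockProb W x y = Real.exp (n * linLog W (typ x y)) := by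
  have hpos : ∀ i, 0 < W (x i) (y i) := by
    intro i
    refine lt_of_le_of_ne (hW _ _) fun h0 => ?_
    have h1 := h _ _ h0.symm
    have h2 : (0 : ℝ) < cnt (pair x y) (x i, y i) := by exact_mod_cast cnt_apply_pos (pair x y) i
    have : 0 < typ x y (x i) (y i) := by unfold typ; positivity
    exact this.ne' h1
  rw [mul_linLog_typ hn, Real.exp_sum]
  exact Finset.prod_congr rfl fun i _ => (Real.exp_log (hpos i)).symm

theorem sum_mul_log_div {ι : Type*} (s : Finset ι) (k : ι → ℕ) (hn : 0 < n)
    (hk : ∑ i ∈ s, k i = n) :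
    n * ∑ i ∈ s, ((k i : ℝ) / n) * Real.log ((k i : ℝ) / n)
      = ∑ i ∈ s, (k i : ℝ) * Real.log (k i) - n * Real.log n := by
  have hn' : (0 : ℝ) < n := by exact_mod_cast hn
  have h1 : (n : ℝ) * Real.log n = ∑ i ∈ s, (k i : ℝ) * Real.log n := by
    rw [← Finset.sum_mul, ← Nat.cast_sum, hk]
  rw [h1, Finset.mul_sum, ← Finset.sum_sub_distrib]
  refine Finset.sum_congr rfl fun i _ => ?_
  rcases Nat.eq_zero_or_pos (k i) with h0 | h0
  · rw [h0]; simp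
  · have h2 : (0 : ℝ) < k i := by exact_mod_cast h0
    rw [Real.log_div h2.ne' hn'.ne']; field_simp

theorem mul_sum_typ_mul_log (hn : 0 < n) (x : Fin n → X) (y : Fin n → Y) :
    n * ∑ a, ∑ b, typ x y a b * Real.log (typ x y a b)
      = ∑ a, ∑ b, (cnt (pair x y) (a, b) : ℝ) * Real.log (cnt (pair x y) (a, b))
        - n * Real.log n := by
  have h := sum_mul_log_div Finset.univ (cnt (pair x y)) hn (sum_cnt _)
  rw [Fintype.sum_prod_type, Fintype.sum_prod_type] at h
  exact h

/-- After exponentiation and for a dominated type, `W(y|x) exp (n D)` is the probability of `y`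
given `x` under their own conditional type. It no longer depends on `W`, so it can be summed over
outputs with only a polynomial bound. -/
theorem mul_divFormula_typ (hn : 0 < n) (W : X → Y → ℝ) (x : Fin n → X) (y : Fin n → Y) :
    n * divFormula W (typ x y) = selfLog y x - n * linLog W (typ x y) := by
  have h1 := mul_sum_typ_mul_log hn x y
  have h2 := sum_mul_log_div Finset.univ (cnt x) hn (sum_cnt _)
  have h3 : ∑ b, ∑ a, (cnt (pair y x) (b, a) : ℝ) * Real.log (cnt (pair y x) (b, a))
      = ∑ a, ∑ b, (cnt (pair x y) (a, b) : ℝ) * Real.log (cnt (pair x y) (a, b)) := by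
    rw [Finset.sum_comm]
    exact Finset.sum_congr rfl fun a _ => Finset.sum_congr rfl fun b _ => by
      rw [cnt_pair_swap x y]
  simp only [divFormula, margX_typ, selfLog]
  rw [mul_sub, mul_sub, h1, h2, h3]; ring

/-- The added bracket is `n` times the entropy of the type of `x`, hence constant on a type class.
Averages of `exp (n I)` over the class thus reduce to sums of `exp (selfLog x y)`. -/
theorem mul_infoFormula_typ (hn : 0 < n) (x : Fin n → X) (y : Fin n → Y) :
    n * infoFormula (typ x y) = selfLog x y
      + (n * Real.log n - ∑ a, (cnt x a : ℝ) * Real.log (cnt x a)) := by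
  have h1 := mul_sum_typ_mul_log hn x y
  have h2 := sum_mul_log_div Finset.univ (cnt x) hn (sum_cnt _)
  have h3 := sum_mul_log_div Finset.univ (cnt y) hn (sum_cnt _)
  simp only [infoFormula, margX_typ, margY_typ, selfLog]
  rw [mul_sub, mul_sub, h1, h2, h3]; ring

/-- Summed over the channel output, `W(y|x) exp (n D)` is at most the number of joint types. -/
theorem sum_blockProb_mul_exp_le (hn : 0 < n) {W : X → Y → ℝ} (hW : ∀ a b, 0 ≤ W a b)
    (x : Fin n → X) :
    ∑ y : Fin n → Y, blockProb W x y * Real.exp (n * divFormula W (typ x y))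
      ≤ ((n : ℝ) + 1) ^ (Fintype.card X * Fintype.card Y) := by
  rw [mul_comm (Fintype.card X)]
  refine le_trans (Finset.sum_le_sum fun y _ => ?_) (sum_exp_selfLog_le x)
  by_cases h : blockProb W x y = 0
  · rw [h, zero_mul]; positivity
  · rw [blockProb_eq_exp hn hW (dominated_typ_of_blockProb_ne_zero h), ← Real.exp_add,
      mul_divFormula_typ hn]
    exact le_of_eq (by ring_nf)

theorem log_card_typeClass (x : Fin n → X) :
    Real.log ((typeClass x).card : ℝ)
      = Real.log (n.factorial : ℝ) - ∑ a, Real.log ((cnt x a).factorial : ℝ) := by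
  have h := card_typeClass_mul x
  have h0 : (typeClass x).card ≠ 0 := fun h0 => by
    rw [h0, zero_mul] at h; exact n.factorial_ne_zero h.symm
  rw [← h]
  push_cast
  rw [Real.log_mul (by exact_mod_cast h0) (Finset.prod_ne_zero_iff.2 fun a _ => by positivity),
    Real.log_prod fun a _ => by positivity]
  ring

theorem card_typeClass_pos (x : Fin n → X) : 0 < (typeClass x).card :=
  Finset.card_pos.2 ⟨x, mem_typeClass.2 rfl⟩

theorem le_log_card_typeClass (x : Fin n → X) :
    n * Real.log n - ∑ a, (cnt x a : ℝ) * Real.log (cnt x a)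
      - Fintype.card X * stirlingLoss n ≤ Real.log ((typeClass x).card : ℝ) := by
  rw [log_card_typeClass]
  have h1 := le_log_factorial n
  have h2 : ∑ a, Real.log ((cnt x a).factorial : ℝ)
      ≤ ∑ a, ((cnt x a : ℝ) * Real.log (cnt x a) - cnt x a + stirlingLoss n) :=
    Finset.sum_le_sum fun a _ => log_factorial_le_of_le (cnt_le x a)
  rw [Finset.sum_add_distrib, Finset.sum_sub_distrib, ← Nat.cast_sum, sum_cnt] at h2
  simp only [Finset.sum_const, Finset.card_univ, nsmul_eq_mul] at h2
  linarith

/-- Averaged over a type class, `exp (n I)` is polynomially bounded. -/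
theorem sum_typeClass_exp_le (hn : 0 < n) (x : Fin n → X) (y : Fin n → Y) :
    ∑ x' ∈ typeClass x, Real.exp (n * infoFormula (typ x' y))
      ≤ (typeClass x).card * (Real.exp (Fintype.card X * stirlingLoss n)
        * ((n : ℝ) + 1) ^ (Fintype.card X * Fintype.card Y)) := by
  have h1 : Real.exp (n * Real.log n - ∑ a, (cnt x a : ℝ) * Real.log (cnt x a))
      ≤ (typeClass x).card * Real.exp (Fintype.card X * stirlingLoss n) := by
    have hpos : (0 : ℝ) < (typeClass x).card := by exact_mod_cast card_typeClass_pos x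
    rw [← Real.exp_log hpos, ← Real.exp_add, Real.exp_le_exp]
    linarith [le_log_card_typeClass x]
  calc ∑ x' ∈ typeClass x, Real.exp (n * infoFormula (typ x' y))
      = ∑ x' ∈ typeClass x, Real.exp (selfLog x' y)
        * Real.exp (n * Real.log n - ∑ a, (cnt x a : ℝ) * Real.log (cnt x a)) := by
        refine Finset.sum_congr rfl fun x' hx' => ?_
        rw [mul_infoFormula_typ hn, mem_typeClass.1 hx', Real.exp_add]
    _ = (∑ x' ∈ typeClass x, Real.exp (selfLog x' y))
        * Real.exp (n * Real.log n - ∑ a, (cnt x a : ℝ) * Real.log (cnt x a)) := by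
        rw [Finset.sum_mul]
    _ ≤ ((n : ℝ) + 1) ^ (Fintype.card X * Fintype.card Y)
        * ((typeClass x).card * Real.exp (Fintype.card X * stirlingLoss n)) := by
        refine mul_le_mul ?_ h1 (by positivity) (by positivity)
        exact (Finset.sum_le_sum_of_subset_of_nonneg (Finset.subset_univ _)
          fun _ _ _ => by positivity).trans (sum_exp_selfLog_le y)
    _ = _ := by ring

/-- A conditional type class has relative size about `exp (-n I)` in the type class. -/
theorem card_condClass_ge (hn : 0 < n) (x : Fin n → X) (y : Fin n → Y) :
    (typeClass x).card * Real.exp (-(n * infoFormula (typ x y))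
        - (1 + Fintype.card X * Fintype.card Y) * stirlingLoss n)
      ≤ ((Finset.univ.filter fun x' => cnt (pair x' y) = cnt (pair x y)).card : ℝ) := by
  set K := Finset.univ.filter fun x' => cnt (pair x' y) = cnt (pair x y) with hK
  have hKpos : (0 : ℝ) < K.card := by
    exact_mod_cast Finset.card_pos.2 ⟨x, by simp [hK]⟩
  have hTpos : (0 : ℝ) < (typeClass x).card := by exact_mod_cast card_typeClass_pos x
  have h := card_condClass_mul x y
  rw [← hK] at h
  have hlog : Real.log K.card + ∑ z, Real.log ((cnt (pair x y) z).factorial : ℝ)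
      = ∑ b, Real.log ((cnt y b).factorial : ℝ) := by
    rw [← Real.log_prod fun z _ => by positivity, ← Real.log_prod fun z _ => by positivity,
      ← Real.log_mul hKpos.ne' (Finset.prod_ne_zero_iff.2 fun z _ => by positivity)]
    congr 1
    exact_mod_cast h
  have h1 : ∑ z, Real.log ((cnt (pair x y) z).factorial : ℝ)
      ≤ ∑ z, ((cnt (pair x y) z : ℝ) * Real.log (cnt (pair x y) z) - cnt (pair x y) z
        + stirlingLoss n) :=
    Finset.sum_le_sum fun z _ => log_factorial_le_of_le (cnt_le _ z)
  rw [Finset.sum_add_distrib, Finset.sum_sub_distrib, ← Nat.cast_sum, sum_cnt,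
    Fintype.sum_prod_type (f := fun z => (cnt (pair x y) z : ℝ) * Real.log (cnt (pair x y) z))] at h1
  simp only [Finset.sum_const, Finset.card_univ, nsmul_eq_mul, Fintype.card_prod,
    Nat.cast_mul] at h1
  have h2 : ∑ b, ((cnt y b : ℝ) * Real.log (cnt y b) - cnt y b)
      ≤ ∑ b, Real.log ((cnt y b).factorial : ℝ) :=
    Finset.sum_le_sum fun b _ => le_log_factorial _
  rw [Finset.sum_sub_distrib, ← Nat.cast_sum, sum_cnt] at h2
  have h3 : ∑ a, ((cnt x a : ℝ) * Real.log (cnt x a) - cnt x a)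
      ≤ ∑ a, Real.log ((cnt x a).factorial : ℝ) :=
    Finset.sum_le_sum fun b _ => le_log_factorial _
  rw [Finset.sum_sub_distrib, ← Nat.cast_sum, sum_cnt] at h3
  have h4 := log_factorial_le_of_le (le_refl n)
  rw [← Real.exp_log hKpos, ← Real.exp_log hTpos, ← Real.exp_add, Real.exp_le_exp,
    log_card_typeClass, mul_infoFormula_typ hn, selfLog]
  linarith

end TypeEstimates

/-! ### From error events on words to the single-letter exponents. -/

section SingleLetterBounds

variable {X Y : Type*} [Fintype X] [Fintype Y]

theorem dist_margY_le (Q Q' : X → Y → ℝ) :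
    dist (margY Q) (margY Q') ≤ Fintype.card X * dist Q Q' := by
  refine (dist_pi_le_iff (by positivity)).2 fun y => ?_
  rw [Real.dist_eq, margY, margY, ← Finset.sum_sub_distrib]
  refine (Finset.abs_sum_le_sum_abs _ _).trans ?_
  calc ∑ x, |Q x y - Q' x y| ≤ ∑ _x : X, dist Q Q' := Finset.sum_le_sum fun x _ =>
        (dist_le_pi_dist (Q x) (Q' x) y).trans (dist_le_pi_dist Q Q' x)
    _ = _ := by simp

/-- The loss is logarithmic in `n`, so every polynomial factor is eventually absorbed into `exp (n
ε)`. -/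
theorem eventually_mul_stirlingLoss_le (C : ℝ) {ε : ℝ} (hε : 0 < ε) :
    ∀ᶠ n : ℕ in atTop, C * stirlingLoss n ≤ n * ε := by
  have h1 : Tendsto (fun n : ℕ => ((n : ℝ) + 1)) atTop atTop :=
    tendsto_atTop_add_const_right _ _ tendsto_natCast_atTop_atTop
  have h2 := (Real.isLittleO_log_id_atTop.comp_tendsto h1).def
    (show 0 < ε / 2 / (|C| + 1) by positivity)
  have h3 : ∀ᶠ n : ℕ in atTop, (ε / 2 / (|C| + 1) + 1) / (ε / 2 / (|C| + 1)) ≤ (n : ℝ) :=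
    tendsto_natCast_atTop_atTop.eventually_ge_atTop _
  filter_upwards [h2, h3] with n hn hn'
  set c := ε / 2 / (|C| + 1) with hc
  have hc0 : 0 < c := by positivity
  rw [div_le_iff₀ hc0] at hn'
  simp only [Function.comp_apply, id_eq, Real.norm_eq_abs] at hn
  rw [abs_of_nonneg (show (0 : ℝ) ≤ (n : ℝ) + 1 by positivity)] at hn
  have h4 : stirlingLoss n ≤ 2 * c * n := by
    have := (le_abs_self _).trans hn
    unfold stirlingLoss
    linarith
  calc C * stirlingLoss n ≤ (|C| + 1) * (2 * c * n) := by
        refine mul_le_mul ?_ h4 (stirlingLoss_nonneg n) (by positivity)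
        linarith [le_abs_self C]
    _ = n * ε := by rw [hc]; field_simp

variable [DecidableEq X] [DecidableEq Y]

/-- If `Q` has margins close to those of the joint type of `(x, y)`, then about `exp (-n I(Q))` of
the type class of `x` has likelihood about `exp (n f_W(Q))` or more. -/
theorem exists_card_likelihood_ge {W : X → Y → ℝ} (hW : ∀ a b, 0 ≤ W a b) {ε : ℝ} (hε : 0 < ε) :
    ∃ η > 0, ∀ᶠ n : ℕ in atTop, ∀ (x : Fin n → X) (y : Fin n → Y), blockProb W x y ≠ 0 →
      ∀ Q : X → Y → ℝ, (∀ a b, 0 ≤ Q a b) → ∑ a, ∑ b, Q a b = 1 → Dominated Q W →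
      dist (margX (typ x y)) (margX Q) ≤ η → dist (margY (typ x y)) (margY Q) ≤ η →
      ∀ t r : ℝ, t + ε ≤ linLog W Q → infoFormula Q ≤ r - ε →
      (typeClass x).card * Real.exp (-(n * r)) ≤
        (((typeClass x).filter fun x' => Real.exp (n * t) < blockProb W x' y).card : ℝ) := by
  obtain ⟨η₁, hη₁, hlin⟩ := exists_uniform_dist (continuous_linLog W) (half_pos hε)
  obtain ⟨η₂, hη₂, hinf⟩ := exists_uniform_dist
    (continuous_infoFormula (X := X) (Y := Y)) (half_pos hε)
  set η₃ := min η₁ η₂ with hη₃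
  have hη₃0 : 0 < η₃ := lt_min hη₁ hη₂
  obtain ⟨η, hη, hopen⟩ := exists_close_same_margins (fun a b => W a b = 0) (half_pos hη₃0)
  have hN1 : ∀ᶠ n : ℕ in atTop, 1 / (n : ℝ) ≤ η₃ / 2 :=
    (tendsto_one_div_atTop_nhds_zero_nat.eventually_lt_const (half_pos hη₃0)).mono
      fun n hn => hn.le
  refine ⟨η, hη, ?_⟩
  filter_upwards [hN1, eventually_gt_atTop 0,
    eventually_mul_stirlingLoss_le (1 + Fintype.card X * Fintype.card Y) (half_pos hε)]
    with n hn1 hn hst x y hxy Q hQ hQ1 hQW hX hY t r ht hr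
  have hn' : (0 : ℝ) < n := by exact_mod_cast hn
  have hAW := dominated_typ_of_blockProb_ne_zero hxy
  -- Three approximations follow. `Q` is moved to `B` with the exact margins of the type of `(x,
  -- y)`, `n B` is rounded to integers with the same margins, and the integer matrix is realized by
  -- a word `x'` paired with the given `y`. Zeros of `W` are respected throughout, so the likelihood
  -- stays finite and continuous.
  obtain ⟨B, hB0, hBW, hBX, hBY, hBQ⟩ := hopen (typ x y)
    (le_one_of_sum (typ_nonneg x y) (sum_typ hn x y)) Q (le_one_of_sum hQ hQ1) hAW hQW hX hY
  have hnBX : ∀ a, margX (fun a b => n * B a b) a = cnt x a := fun a => by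
    have := congrFun hBX a
    rw [margX_typ] at this
    simp only [margX] at this ⊢
    rw [← Finset.mul_sum, this]; field_simp
  have hnBY : ∀ b, margY (fun a b => n * B a b) b = cnt y b := fun b => by
    have := congrFun hBY b
    rw [margY_typ] at this
    simp only [margY] at this ⊢
    rw [← Finset.mul_sum, this]; field_simp
  obtain ⟨N, hNB, hN0, hNX, hNY⟩ := exists_nat_matrix (fun a b => n * B a b)
    (fun a b => mul_nonneg hn'.le (hB0 a b)) (fun a => ⟨_, (hnBX a).symm⟩)
    fun b => ⟨_, (hnBY b).symm⟩
  obtain ⟨x', hx'⟩ := exists_word_of_cnt y N fun b => by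
    have := (hNY b).trans (hnBY b)
    exact_mod_cast this
  have hcnt : cnt x' = cnt x := by
    funext a
    rw [← sum_cnt_pair_right x' y a]
    simp only [hx']
    have := (hNX a).trans (hnBX a)
    exact_mod_cast this
  have htyp : ∀ a b, typ x' y a b = N a b / n := fun a b => by rw [typ, hx']
  have hd : Dominated (typ x' y) W := fun a b hw => by
    rw [htyp, hN0 a b (by rw [hBW a b hw, mul_zero])]; simp
  have hdist : dist (typ x' y) Q ≤ η₃ := by
    have h1 : dist (typ x' y) B ≤ 1 / n := by
      refine (dist_pi_le_iff (by positivity)).2 fun a => (dist_pi_le_iff (by positivity)).2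
        fun b => ?_
      rw [Real.dist_eq, htyp]
      have : (N a b : ℝ) / n - B a b = (N a b - n * B a b) / n := by field_simp
      rw [this, abs_div, abs_of_pos hn']
      gcongr
      exact hNB a b
    linarith [dist_triangle (typ x' y) B Q]
  have hmem := le_one_of_sum (typ_nonneg x' y) (sum_typ hn x' y)
  have hl := (abs_le.1 (hlin _ hmem _ (le_one_of_sum hQ hQ1) (hdist.trans (min_le_left _ _)))).1
  have hi := (abs_le.1 (hinf _ hmem _ (le_one_of_sum hQ hQ1) (hdist.trans (min_le_right _ _)))).2
  have hTT : typeClass x' = typeClass x := by simp only [typeClass, hcnt]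
  have hge := card_condClass_ge hn x' y
  rw [hTT] at hge
  refine le_trans ?_ (hge.trans ?_)
  · gcongr
    nlinarith
  · norm_cast
    refine Finset.card_le_card fun z hz => ?_
    simp only [Finset.mem_filter, Finset.mem_univ, true_and] at hz
    have hzt : typ z y = typ x' y := by
      funext a b; rw [typ, typ, hz]
    refine Finset.mem_filter.2 ⟨mem_typeClass.2 ?_, ?_⟩
    · rw [← hcnt]
      funext a
      rw [← sum_cnt_pair_right z y a, hz, sum_cnt_pair_right]
    · rw [blockProb_eq_exp hn hW (by rwa [hzt]), hzt, Real.exp_lt_exp]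
      gcongr
      linarith

/-- Two joint distributions with the same margins, the `X`-marginal close to `P`, can be moved
simultaneously to the `X`-marginal `P`. -/
theorem exists_joint_perturbation {W V : X → Y → ℝ} {P : X → ℝ} (hP : P ∈ stdSimplex ℝ X) {ε : ℝ}
    (hε : 0 < ε) :
    ∃ η > 0, ∀ A B : X → Y → ℝ, (∀ x y, 0 ≤ A x y) → (∀ x y, 0 ≤ B x y) →
      ∑ x, ∑ y, A x y = 1 → Dominated A W → Dominated B V → margX B = margX A →
      margY B = margY A → (∀ x, P x = 0 → margX A x = 0) → dist (margX A) P ≤ η →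
      ∃ A' B' : X → Y → ℝ, A' ∈ joints P ∧ B' ∈ joints P ∧ Dominated A' W ∧ Dominated B' V ∧
        margY B' = margY A' ∧ dist A A' ≤ ε ∧ dist B B' ≤ ε ∧
        ((∃ x y, 0 < B x y ∧ W x y = 0) → ∃ x y, 0 < B' x y ∧ W x y = 0) ∧ (B = A → B' = A') := by
  obtain ⟨t, ht0, ht1, ht2⟩ : ∃ t : ℝ, 0 < t ∧ t < 1 ∧ 2 * t ≤ ε / 2 :=
    ⟨min (1 / 2) (ε / 4), by positivity, by linarith [min_le_left (1 / 2 : ℝ) (ε / 4)],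
      by linarith [min_le_right (1 / 2 : ℝ) (ε / 4)]⟩
  obtain ⟨η₁, hη₁, hmul⟩ := exists_mul_le P hP.1 ht0 ht1.le
  -- If each symbol of positive probability has an output possible under both channels, the missing
  -- mass of `A` and of `B` is put there. Scaling by `1 - t > 0` keeps positive entries positive, so
  -- a hit on a zero of `W` survives.
  by_cases hcase : ∀ x, 0 < P x → ∃ y, W x y ≠ 0 ∧ V x y ≠ 0
  · refine ⟨min η₁ (ε / 2), by positivity, fun A B hA hB hA1 hAW hBV hX hY h0 hd => ?_⟩
    obtain ⟨hcP, -⟩ := hmul (margX A) h0 (hd.trans (min_le_left _ _))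
    have hcP' : ∀ x, (1 - t) * margX B x ≤ P x := by rwa [hX]
    have hc : 0 ≤ 1 - t := by linarith
    have hYne : Nonempty Y := by
      by_contra hne
      rw [not_nonempty_iff] at hne
      simp at hA1
    have : ∀ x, ∃ y, 0 < P x → W x y ≠ 0 ∧ V x y ≠ 0 := fun x => by
      by_cases hx : 0 < P x
      · exact (hcase x hx).imp fun y hy _ => hy
      · exact ⟨Classical.arbitrary Y, fun h => absurd h hx⟩
    choose s hs using this
    have hB1 : ∑ x, ∑ y, B x y = 1 := by
      rw [sum_sum_eq_sum_margY, hY, ← sum_sum_eq_sum_margY, hA1]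
    have hd2 := hd.trans (min_le_right _ _)
    refine ⟨shiftMarg P s (1 - t) A, shiftMarg P s (1 - t) B,
      shiftMarg_mem_joints hP.2 hA hc hcP, shiftMarg_mem_joints hP.2 hB hc hcP',
      dominated_shiftMarg hP.1 hA hc hcP hAW fun x hx => (hs x hx).1,
      dominated_shiftMarg hP.1 hB hc hcP' hBV fun x hx => (hs x hx).2,
      margY_shiftMarg_congr hX hY, ?_, ?_, ?_, fun h => by rw [h]⟩
    · exact (dist_shiftMarg_le ht0.le hA hA1).trans (by linarith)
    · refine (dist_shiftMarg_le ht0.le hB hB1).trans ?_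
      rw [hX]; linarith
    · rintro ⟨x, y, hxy, hw⟩
      refine ⟨x, y, ?_, hw⟩
      unfold shiftMarg
      have h1 : 0 < (1 - t) * B x y := mul_pos (by linarith) hxy
      split_ifs
      · linarith [hcP' x]
      · linarith
  -- Otherwise at some `x₀` with `P x₀ > 0` the two channels have disjoint supports. Every
  -- distribution dominated by `V` with `X`-marginal `P` then meets a zero of `W`, so there is no
  -- hit to preserve. The case `B = A` cannot occur, because `A` carries mass at `x₀` and would be
  -- dominated by both channels. A merely compact approximation suffices.
  · push Not at hcase
    obtain ⟨x₀, hx₀, hno⟩ := hcase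
    obtain ⟨η₂, hη₂, hpair⟩ := exists_close_pair W V P hε
    refine ⟨min η₁ η₂, lt_min hη₁ hη₂, fun A B hA hB hA1 hAW hBV hX hY h0 hd => ?_⟩
    obtain ⟨-, hpos⟩ := hmul (margX A) h0 (hd.trans (min_le_left _ _))
    obtain ⟨A', B', hA', hB', hA'W, hB'V, hY', hdA, hdB⟩ := hpair A B hA hB hA1 hAW hBV hY
      (hd.trans (min_le_right _ _)) (by rw [hX]; exact hd.trans (min_le_right _ _))
    refine ⟨A', B', hA', hB', hA'W, hB'V, hY', hdA, hdB, fun _ => ?_, fun hBA => ?_⟩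
    · by_contra! hcon
      have : margX B' x₀ = 0 := Finset.sum_eq_zero fun y _ => by
        by_contra hne
        have h1 := hcon x₀ y (lt_of_le_of_ne (hB'.1 x₀ y) (Ne.symm hne))
        exact hne (hB'V _ _ (hno y h1))
      rw [hB'.2.2] at this
      exact hx₀.ne' this
    · exfalso
      have : margX A x₀ = 0 := Finset.sum_eq_zero fun y _ => by
        by_cases hw : W x₀ y = 0
        · exact hAW _ _ hw
        · have := hBV _ _ (hno y hw)
          rwa [hBA] at this
      exact (hpos x₀ hx₀).ne' this

/-- The codeword `x'` beats, on the output `y`, both itself and the transmitted codeword `x` in the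
likelihood comparison with parameter `a`, and fewer than `exp (-n r)` of its type class would
prevent this. -/
def IsErrorTriple {n : ℕ} (W V : X → Y → ℝ) (a r : ℝ) (x x' : Fin n → X) (y : Fin n → Y) : Prop :=
  Real.exp (n * a) * blockProb W x y ≤ blockProb V x' y ∧
  Real.exp (n * a) * blockProb W x' y ≤ blockProb V x' y ∧
  (((typeClass x').filter fun z => blockProb V x' y < Real.exp (n * a) * blockProb W z y).card : ℝ)
    < (typeClass x').card * Real.exp (-(n * r))

/-- The joint types of an error triple, moved to the exact `X`-marginal `P`, become feasible for the
relaxed minimization at `(R - δ, a - δ)`. The likelihood constraints follow from the first two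
clauses of the triple and the constraint on `tL` from the third. When the transmitted word is its
own competitor, the two moved types coincide and are feasible for `E_A`. -/
theorem exponents_le_of_isErrorTriple {W V : X → Y → ℝ} (hW : ∀ a b, 0 ≤ W a b)
    (hV : ∀ a b, 0 ≤ V a b) {P : X → ℝ} (hP : P ∈ stdSimplex ℝ X) (R a : ℝ) {δ : ℝ} (hδ : 0 < δ) :
    ∃ η > 0, ∀ᶠ n : ℕ in atTop, ∀ (x x' : Fin n → X) (y : Fin n → Y), cnt x' = cnt x →
      (∀ s, P s = 0 → cnt x s = 0) → dist (fun s => (cnt x s : ℝ) / n) P ≤ η →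
      blockProb W x y ≠ 0 → IsErrorTriple W V a (R - δ / 2) x x' y →
      expB (R - δ) (a - δ) P W V ≤ ((divFormula W (typ x y)
        + max (infoFormula (typ x' y) - R) 0 + 2 * δ : ℝ) : EReal) ∧
      (x' = x → expA (R - δ) (a - δ) P W V ≤ ((divFormula W (typ x y) + 2 * δ : ℝ) : EReal)) := by
  -- Each constraint loses only a few `ε` by continuity. The information constraint has only the gap
  -- between `R - δ` and `R - δ / 2` available, so `ε` must fit inside `δ / 2`.
  set ε := δ / 8 with hε
  have hε0 : 0 < ε := by positivity
  obtain ⟨η₁, hη₁, hkey⟩ := exists_card_likelihood_ge hW hε0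
  obtain ⟨η₂, hη₂, hlW⟩ := exists_uniform_dist (continuous_linLog W) hε0
  obtain ⟨η₃, hη₃, hlV⟩ := exists_uniform_dist (continuous_linLog V) hε0
  obtain ⟨η₄, hη₄, hdW⟩ := exists_uniform_dist (continuous_divFormula W) hε0
  obtain ⟨η₅, hη₅, hI⟩ := exists_uniform_dist (continuous_infoFormula (X := X) (Y := Y)) hε0
  obtain ⟨ρ, hρ0, hρ1, hρ2, hρ3, hρ4, hρ5⟩ : ∃ ρ > 0, ρ ≤ η₂ ∧ ρ ≤ η₃ ∧ ρ ≤ η₄ ∧ ρ ≤ η₅ ∧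
      Fintype.card X * ρ ≤ η₁ := by
    refine ⟨min (min η₂ η₃) (min (min η₄ η₅) (η₁ / (Fintype.card X + 1))), by positivity,
      (min_le_left _ _).trans (min_le_left _ _), (min_le_left _ _).trans (min_le_right _ _),
      (min_le_right _ _).trans ((min_le_left _ _).trans (min_le_left _ _)),
      (min_le_right _ _).trans ((min_le_left _ _).trans (min_le_right _ _)), ?_⟩
    calc _ ≤ (Fintype.card X : ℝ) * (η₁ / (Fintype.card X + 1)) := by
          gcongr; exact (min_le_right _ _).trans (min_le_right _ _)
      _ ≤ (Fintype.card X + 1) * (η₁ / (Fintype.card X + 1)) := by gcongr; linarith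
      _ = η₁ := by field_simp
  obtain ⟨η₆, hη₆, hpert⟩ := exists_joint_perturbation (W := W) (V := V) hP hρ0
  refine ⟨min η₁ η₆, lt_min hη₁ hη₆, ?_⟩
  filter_upwards [hkey, eventually_gt_atTop 0] with n hkey hn x x' y hcnt hP0 hd hxy hbad
  obtain ⟨hb1, hb2, hb3⟩ := hbad
  have hn' : (0 : ℝ) < n := by exact_mod_cast hn
  have hWpos : 0 < blockProb W x y := lt_of_le_of_ne (blockProb_nonneg hW x y) (Ne.symm hxy)
  have hVpos : 0 < blockProb V x' y := lt_of_lt_of_le (by positivity) hb1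
  have hAW := dominated_typ_of_blockProb_ne_zero hxy
  have hBV := dominated_typ_of_blockProb_ne_zero hVpos.ne'
  have hAX : margX (typ x y) = fun s => (cnt x s : ℝ) / n := funext (margX_typ x y)
  have hBX : margX (typ x' y) = margX (typ x y) := by
    funext s; rw [margX_typ, margX_typ, hcnt]
  have hBY : margY (typ x' y) = margY (typ x y) := by
    funext s; rw [margY_typ, margY_typ]
  obtain ⟨A, B, hA, hB, hAW', hBV', hY, hdA, hdB, hhit, hsame⟩ := hpert (typ x y) (typ x' y)
    (typ_nonneg x y) (typ_nonneg x' y) (sum_typ hn x y) hAW hBV hBX hBY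
    (fun s hs => by rw [margX_typ, hP0 s hs]; simp)
    (by rw [hAX]; exact hd.trans (min_le_right _ _))
  have mA := le_one_of_sum (typ_nonneg x y) (sum_typ hn x y)
  have mB := le_one_of_sum (typ_nonneg x' y) (sum_typ hn x' y)
  have mA' := le_one_of_sum hA.1 hA.2.1
  have mB' := le_one_of_sum hB.1 hB.2.1
  have c1 := abs_le.1 (hlW _ mA _ mA' (hdA.trans hρ1))
  have c2 := abs_le.1 (hlW _ mB _ mB' (hdB.trans hρ1))
  have c3 := abs_le.1 (hlV _ mB _ mB' (hdB.trans hρ2))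
  have c4 := abs_le.1 (hdW _ mA _ mA' (hdA.trans hρ3))
  have c5 := abs_le.1 (hI _ mB _ mB' (hdB.trans hρ4))
  rw [blockProb_eq_exp hn hV hBV] at hb1 hb2 hb3
  have hr1 : a + linLog W (typ x y) ≤ linLog V (typ x' y) := by
    rw [blockProb_eq_exp hn hW hAW, ← Real.exp_add, Real.exp_le_exp, ← mul_add] at hb1
    exact le_of_mul_le_mul_left hb1 hn'
  -- the likelihood constraint on the competitor
  have hself : loglik W B ≤ -((a - δ : ℝ) : EReal) + loglik V B := by
    by_cases hex : ∃ x y, 0 < B x y ∧ W x y = 0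
    · rw [loglik_of_exists hex]; exact bot_le
    -- If `f_W(B)` is finite, the preserved hits show that the likelihood of the original type is
    -- finite too, so the comparison on words can be read off exponents and transferred by
    -- continuity.
    · have hnex : ¬ ∃ s b, 0 < typ x' y s b ∧ W s b = 0 := fun h => hex (hhit h)
      have hBW := dominated_of_not_exists (typ_nonneg x' y) hnex
      have hr2 : a + linLog W (typ x' y) ≤ linLog V (typ x' y) := by
        rw [blockProb_eq_exp hn hW hBW, ← Real.exp_add, Real.exp_le_exp, ← mul_add] at hb2
        exact le_of_mul_le_mul_left hb2 hn'
      rw [loglik_of_dominated (dominated_of_not_exists hB.1 hex), loglik_of_dominated hBV',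
        ← EReal.coe_neg, ← EReal.coe_add, EReal.coe_le_coe_iff]
      linarith [c2.1, c2.2, c3.1, c3.2]
  -- A violating `Q` would provide, through `hkey`, at least a fraction `exp (-n (R - δ / 2))` of
  -- the type class preventing the dominance, against the third clause of the error triple.
  have htL : ((R - δ : ℝ) : EReal) ≤ tL (a - δ) P W (margY A) (loglik V B) := by
    refine le_iInf₂ fun Q hQ => ?_
    obtain ⟨hQ, hQY, hbot, hle⟩ := hQ
    have hQW : Dominated Q W := by
      refine dominated_of_not_exists hQ.1 fun hex => ?_
      rw [loglik_of_exists hex] at hbot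
      exact lt_irrefl _ hbot
    rw [loglik_of_dominated hQW, loglik_of_dominated hBV', ← EReal.coe_neg, ← EReal.coe_sub,
      ← EReal.coe_add, ← EReal.coe_zero, EReal.coe_le_coe_iff] at hle
    rw [EReal.coe_le_coe_iff]
    by_contra! hlt
    rw [mutualInfo_eq hQ.1] at hlt
    have hmargY : dist (margY (typ x y)) (margY Q) ≤ η₁ := by
      rw [hQY]
      exact (dist_margY_le _ _).trans
        ((mul_le_mul_of_nonneg_left hdA (Nat.cast_nonneg _)).trans hρ5)
    have := hkey x y hxy Q hQ.1 hQ.2.1 hQW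
      (by rw [hQ.2.2, hAX]; exact hd.trans (min_le_left _ _)) hmargY
      (linLog V (typ x' y) - a) (R - δ / 2) (by linarith [c3.1, c3.2]) (by linarith)
    have hTT : typeClass x' = typeClass x := by simp only [typeClass, hcnt]
    rw [hTT] at hb3
    refine absurd hb3 (not_lt.2 (this.trans (le_of_eq ?_)))
    congr 2
    refine Finset.filter_congr fun z _ => ?_
    rw [mul_sub, Real.exp_sub, div_lt_iff₀ (Real.exp_pos _), mul_comm (blockProb W z y)]
  constructor
  · have hmem : (A, B) ∈ domB (R - δ) (a - δ) P W V := by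
      refine ⟨hA, hB, hY, hself, ?_, htL⟩
      rw [loglik_of_dominated hAW', loglik_of_dominated hBV', ← EReal.coe_add,
        EReal.coe_le_coe_iff]
      linarith [c1.1, c1.2, c3.1, c3.2]
    refine (iInf₂_le _ hmem).trans ?_
    rw [condDiv_of_dominated hA.1 hAW', ← EReal.coe_add, EReal.coe_le_coe_iff,
      mutualInfo_eq hB.1]
    have hmax : max (infoFormula B - (R - δ)) 0 ≤ max (infoFormula (typ x' y) - R) 0 + δ + ε := by
      refine max_le ?_ ?_
      · linarith [le_max_left (infoFormula (typ x' y) - R) 0, c5.1, c5.2]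
      · linarith [le_max_right (infoFormula (typ x' y) - R) 0]
    linarith [c4.1, c4.2]
  · rintro rfl
    -- Both words have the same type with `y`, and the perturbation treats equal inputs equally; a
    -- single distribution then meets all constraints of `domA`.
    have hBA : B = A := hsame rfl
    subst hBA
    refine (iInf₂_le B ⟨hB, hself, htL⟩).trans ?_
    rw [condDiv_of_dominated hA.1 hAW', EReal.coe_le_coe_iff]
    linarith [c4.1, c4.2]

end SingleLetterBounds

/-! ### Averaging over the constant composition ensemble. -/

section RandomCoding

section Counting

variable {A : Type*} [DecidableEq A] {M : ℕ}

theorem card_codes (T : Finset A) : (Fintype.piFinset fun _ : Fin M => T).card = T.card ^ M := by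
  simp

theorem card_codes_fix {T : Finset A} {x : A} (hx : x ∈ T) {S : Finset A} (hS : S ⊆ T)
    (m : Fin M) :
    ((Fintype.piFinset fun _ : Fin M => T).filter fun c => c m = x ∧ ∀ j, j ≠ m → c j ∈ S).card
      = S.card ^ (M - 1) := by
  have : ((Fintype.piFinset fun _ : Fin M => T).filter fun c => c m = x ∧ ∀ j, j ≠ m → c j ∈ S)
      = Fintype.piFinset fun j => if j = m then {x} else S := by
    ext c
    simp only [Finset.mem_filter, Fintype.mem_piFinset]
    constructor
    · rintro ⟨-, h1, h2⟩ j
      by_cases hj : j = m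
      · subst hj; simp [h1]
      · simp [hj, h2 j hj]
    · intro h
      have h1 : c m = x := by simpa using h m
      have h2 : ∀ j, j ≠ m → c j ∈ S := fun j hj => by simpa [hj] using h j
      refine ⟨fun j => ?_, h1, h2⟩
      by_cases hj : j = m
      · rw [hj, h1]; exact hx
      · exact hS (h2 j hj)
  rw [this, Fintype.card_piFinset, ← Finset.mul_prod_erase _ _ (Finset.mem_univ m), if_pos rfl,
    Finset.card_singleton, one_mul, Finset.prod_congr rfl (g := fun _ => S.card)]
  · simp
  · intro j hj
    rw [if_neg (Finset.ne_of_mem_erase hj)]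

/-- Two distinct coordinates behave independently in the uniform ensemble. The extra factor `T.card`
on the left avoids the exponent `M - 2`. -/
theorem card_codes_fix_two {T : Finset A} {x : A} (hx : x ∈ T) {S : Finset A} (hS : S ⊆ T)
    {m m' : Fin M} (hm : m' ≠ m) :
    T.card * ((Fintype.piFinset fun _ : Fin M => T).filter fun c => c m = x ∧ c m' ∈ S).card
      = T.card ^ (M - 1) * S.card := by
  have : ((Fintype.piFinset fun _ : Fin M => T).filter fun c => c m = x ∧ c m' ∈ S)
      = Fintype.piFinset fun j => if j = m then {x} else if j = m' then S else T := by
    ext c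
    simp only [Finset.mem_filter, Fintype.mem_piFinset]
    constructor
    · rintro ⟨h0, h1, h2⟩ j
      by_cases hj : j = m
      · subst hj; simp [h1]
      · by_cases hj' : j = m'
        · subst hj'; simp [hj, h2]
        · simp [hj, hj', h0 j]
    · intro h
      have h1 : c m = x := by simpa using h m
      have h2 : c m' ∈ S := by simpa [hm] using h m'
      refine ⟨fun j => ?_, h1, h2⟩
      by_cases hj : j = m
      · rw [hj, h1]; exact hx
      · by_cases hj' : j = m'
        · rw [hj']; exact hS h2
        · simpa [hj, hj'] using h j
  have hmem : m' ∈ (Finset.univ : Finset (Fin M)).erase m := by simp [hm]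
  rw [this, Fintype.card_piFinset, ← Finset.mul_prod_erase _ _ (Finset.mem_univ m), if_pos rfl,
    Finset.card_singleton, one_mul, ← Finset.mul_prod_erase _ _ hmem, if_neg hm, if_pos rfl,
    Finset.prod_congr rfl (g := fun _ => T.card)]
  · have h2 : 2 ≤ M := by
      have h3 := Finset.card_pos.2 ⟨m', hmem⟩
      rw [Finset.card_erase_of_mem (Finset.mem_univ m)] at h3
      simp at h3
      omega
    rw [Finset.prod_const, Finset.card_erase_of_mem hmem,
      Finset.card_erase_of_mem (Finset.mem_univ m), Finset.card_univ, Fintype.card_fin]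
    obtain ⟨k, rfl⟩ := Nat.exists_eq_add_of_le h2
    have e1 : 2 + k - 1 - 1 = k := by omega
    have e2 : 2 + k - 1 = k + 1 := by omega
    rw [e1, e2, pow_succ]; ring
  · intro j hj
    rw [if_neg (Finset.ne_of_mem_erase (Finset.mem_of_mem_erase hj)),
      if_neg (Finset.ne_of_mem_erase hj)]

end Counting

theorem le_codeSize (R : ℝ) (n : ℕ) : Real.exp (n * R) ≤ codeSize R n := Nat.le_ceil _

theorem codeSize_pos (R : ℝ) (n : ℕ) : 0 < codeSize R n := Nat.ceil_pos.2 (Real.exp_pos _)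

theorem codeSize_le {R : ℝ} (hR : 0 ≤ R) (n : ℕ) : (codeSize R n : ℝ) ≤ 2 * Real.exp (n * R) := by
  have h1 := Nat.ceil_lt_add_one (Real.exp_pos (n * R)).le
  have h2 : 1 ≤ Real.exp (n * R) := Real.one_le_exp (by positivity)
  unfold codeSize
  linarith

variable {X Y : Type*} [Fintype X] [Fintype Y] {n M : ℕ}

/-- Outputs on which some codeword is, under `V`, at least `exp (n a)` times as likely as every
codeword under `W`. -/
def dominanceRegion (W V : X → Y → ℝ) (a : ℝ) (c : Codebook X M n) : Set (Fin n → Y) :=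
  {y | ∃ m, ∀ j, Real.exp (n * a) * blockProb W (c j) y ≤ blockProb V (c m) y}

theorem outputProb_nonneg {U : X → Y → ℝ} (hU : ∀ a b, 0 ≤ U a b) (c : Codebook X M n)
    (S : Set (Fin n → Y)) : 0 ≤ outputProb U c S :=
  mul_nonneg (by positivity) (Finset.sum_nonneg fun m _ => Finset.sum_nonneg fun y _ =>
    Set.indicator_nonneg (fun y _ => blockProb_nonneg hU (c m) y) y)

theorem outputProb_mono {U : X → Y → ℝ} (hU : ∀ a b, 0 ≤ U a b) (c : Codebook X M n)
    {S S' : Set (Fin n → Y)} (h : S ⊆ S') : outputProb U c S ≤ outputProb U c S' := by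
  unfold outputProb
  gcongr with m _ y _
  exact blockProb_nonneg hU (c m) y

theorem rejectL_subset (hM : 0 < M) (W V : X → Y → ℝ) (α : ℝ) (c : Codebook X M n) :
    rejectL W V α c ⊆ dominanceRegion W V α c := by
  have : Nonempty (Fin M) := ⟨⟨0, hM⟩⟩
  intro y hy
  obtain ⟨m, hm⟩ := exists_eq_ciSup_of_finite (f := fun m => blockProb V (c m) y)
  refine ⟨m, fun j => ?_⟩
  rw [hm]
  refine le_trans ?_ (le_of_lt hy)
  gcongr
  exact le_ciSup (f := fun m => blockProb W (c m) y) (Set.finite_range _).bddAbove j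

/-- Negating the rejection inequality and dividing by `exp (n α)` exchanges the channels and the
sign of `α`. The non-strict inequality in `dominanceRegion` is what lets both error events fit one
form. -/
theorem compl_rejectL_subset (hM : 0 < M) (W V : X → Y → ℝ) (α : ℝ) (c : Codebook X M n) :
    (rejectL W V α c)ᶜ ⊆ dominanceRegion V W (-α) c := by
  have : Nonempty (Fin M) := ⟨⟨0, hM⟩⟩
  intro y hy
  obtain ⟨m, hm⟩ := exists_eq_ciSup_of_finite (f := fun m => blockProb W (c m) y)
  refine ⟨m, fun j => ?_⟩
  rw [hm, mul_neg, Real.exp_neg, inv_mul_le_iff₀ (Real.exp_pos _)]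
  refine le_trans ?_ (not_lt.1 hy)
  exact le_ciSup (f := fun m => blockProb V (c m) y) (Set.finite_range _).bddAbove j

variable [DecidableEq X] [DecidableEq Y]

/-- Some word of the code dominates on some output although a fraction `exp (-n r)` or more of its
type class would prevent this. -/
def IsAtypical (W V : X → Y → ℝ) (a r : ℝ) (c : Codebook X M n) : Prop :=
  ∃ y m, (∀ j, Real.exp (n * a) * blockProb W (c j) y ≤ blockProb V (c m) y) ∧
    (typeClass (c m)).card * Real.exp (-(n * r)) ≤ (((typeClass (c m)).filter fun z =>
      blockProb V (c m) y < Real.exp (n * a) * blockProb W z y).card : ℝ)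

open Classical in
/-- The probability of the outputs for which some codeword forms an error triple with the
transmitted one. -/
def tripleProb (W V : X → Y → ℝ) (a r : ℝ) (c : Codebook X M n) : ℝ :=
  (1 / (M : ℝ)) * ∑ m, ∑ y, if ∃ j, IsErrorTriple W V a r (c m) (c j) y
    then blockProb W (c m) y else 0

/-- The dominating codeword is compared only with the transmitted word and with itself. What the
other codewords impose is retained through non-atypicality, which supplies the third clause of an
error triple. -/
theorem outputProb_le_tripleProb {W : X → Y → ℝ} (hW : ∀ a b, 0 ≤ W a b) (V : X → Y → ℝ) (a r : ℝ)
    {c : Codebook X M n} (h : ¬ IsAtypical W V a r c) :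
    outputProb W c (dominanceRegion W V a c) ≤ tripleProb W V a r c := by
  classical
  unfold outputProb tripleProb
  gcongr with m _ y _
  by_cases hy : y ∈ dominanceRegion W V a c
  · rw [Set.indicator_of_mem hy]
    obtain ⟨k, hk⟩ := hy
    rw [if_pos]
    refine ⟨k, hk m, hk k, ?_⟩
    by_contra! hcon
    exact h ⟨y, k, hk, hcon⟩
  · rw [Set.indicator_of_notMem hy]
    split_ifs
    exacts [blockProb_nonneg hW _ _, le_rfl]

-- With `p = exp (-n (R - δ))`, the other `M - 1` codewords all avoid a set of relative size at
-- least `p` with probability at most `(1 - p) ^ (M - 1)`. Since `M p ≥ exp (n δ)`, this is doubly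
-- exponentially small, and a union bound over outputs and codeword positions is affordable.
open Classical in
theorem card_isAtypical_le (W V : X → Y → ℝ) (a : ℝ) {R : ℝ} (δ : ℝ) (x₀ : Fin n → X) :
    (((Fintype.piFinset fun _ : Fin (codeSize R n) => typeClass x₀).filter
        fun c => IsAtypical W V a (R - δ) c).card : ℝ)
      ≤ (Fintype.piFinset fun _ : Fin (codeSize R n) => typeClass x₀).card *
        ((Fintype.card Y : ℝ) ^ n * codeSize R n * Real.exp (1 - Real.exp (n * δ))) := by
  set T := typeClass x₀ with hT
  set M := codeSize R n with hM
  set p := Real.exp (-(n * (R - δ))) with hp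
  let L : (Fin n → Y) → (Fin n → X) → Prop := fun y x =>
    (T.card * p ≤ ((T.filter fun z => blockProb V x y < Real.exp (n * a) * blockProb W z y).card : ℝ))
  let G : (Fin n → Y) → (Fin n → X) → Finset (Fin n → X) := fun y x =>
    T.filter fun z => Real.exp (n * a) * blockProb W z y ≤ blockProb V x y
  have hsub : ((Fintype.piFinset fun _ : Fin M => T).filter
      fun c => IsAtypical W V a (R - δ) c) ⊆
      Finset.univ.biUnion fun y : Fin n → Y => Finset.univ.biUnion fun m : Fin M =>
        (T.filter fun x => L y x).biUnion fun x =>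
          (Fintype.piFinset fun _ : Fin M => T).filter
            fun c => c m = x ∧ ∀ j, j ≠ m → c j ∈ G y x := by
    intro c hc
    obtain ⟨hcT, y, m, hdom, hL⟩ := Finset.mem_filter.1 hc
    have hcT' := Fintype.mem_piFinset.1 hcT
    have hTT : typeClass (c m) = T := by
      have := mem_typeClass.1 (hcT' m)
      simp only [hT, typeClass, this]
    rw [hTT] at hL
    simp only [Finset.mem_biUnion, Finset.mem_univ, true_and]
    refine ⟨y, m, c m, Finset.mem_filter.2 ⟨hcT' m, hL⟩, Finset.mem_filter.2 ⟨hcT, rfl, ?_⟩⟩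
    exact fun j _ => Finset.mem_filter.2 ⟨hcT' j, hdom j⟩
  have hTpos : (0 : ℝ) < T.card := by exact_mod_cast card_typeClass_pos x₀
  have hG : ∀ y x, L y x → ((G y x).card : ℝ) ^ (M - 1)
      ≤ (T.card : ℝ) ^ (M - 1) * Real.exp (1 - Real.exp (n * δ)) := by
    intro y x hL
    have hsplit := Finset.card_filter_add_card_filter_not (s := T)
      (fun z => Real.exp (n * a) * blockProb W z y ≤ blockProb V x y)
    simp only [not_le] at hsplit
    have hsplit' : ((G y x).card : ℝ) + ((T.filter fun z =>
        blockProb V x y < Real.exp (n * a) * blockProb W z y).card : ℝ) = T.card := by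
      exact_mod_cast hsplit
    have h1 : ((G y x).card : ℝ) ≤ T.card * (1 - p) := by
      simp only [L] at hL
      linarith
    -- No set in `T` has relative size above one, so the hypothesis on `x` already forces `p ≤ 1`,
    -- even if `δ > R`. It gives `(M - 1) p ≥ M p - 1`, the origin of the `1` in the exponent.
    have hp1 : p ≤ 1 := by
      by_contra! hcon
      have : (T.card : ℝ) * (1 - p) < 0 := mul_neg_of_pos_of_neg hTpos (by linarith)
      linarith [Nat.cast_nonneg (α := ℝ) (G y x).card]
    have hp0 : 0 < p := Real.exp_pos _
    have h2 : ((G y x).card : ℝ) ≤ T.card * Real.exp (-p) :=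
      h1.trans (by gcongr; exact Real.one_sub_le_exp_neg p)
    calc ((G y x).card : ℝ) ^ (M - 1) ≤ (T.card * Real.exp (-p)) ^ (M - 1) := by gcongr
      _ = (T.card : ℝ) ^ (M - 1) * Real.exp (((M - 1 : ℕ) : ℝ) * -p) := by
          rw [mul_pow, ← Real.exp_nat_mul]
      _ ≤ _ := by
          gcongr
          have h3 : 1 ≤ M := codeSize_pos R n
          rw [Nat.cast_sub h3]
          have h4 : Real.exp (n * δ) ≤ M * p := by
            calc Real.exp (n * δ) = Real.exp (n * R) * p := by
                  rw [hp, ← Real.exp_add]; congr 1; ring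
              _ ≤ M * p := by gcongr; exact le_codeSize R n
          push_cast
          nlinarith
  have hcount : ∀ y m, ((((T.filter fun x => L y x).biUnion fun x =>
      (Fintype.piFinset fun _ : Fin M => T).filter
        fun c => c m = x ∧ ∀ j, j ≠ m → c j ∈ G y x).card : ℕ) : ℝ)
      ≤ (T.card : ℝ) ^ M * Real.exp (1 - Real.exp (n * δ)) := by
    intro y m
    calc _ ≤ ((∑ x ∈ T.filter fun x => L y x, ((Fintype.piFinset fun _ : Fin M => T).filter
            fun c => c m = x ∧ ∀ j, j ≠ m → c j ∈ G y x).card : ℕ) : ℝ) := by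
          exact_mod_cast Finset.card_biUnion_le
      _ = ∑ x ∈ T.filter fun x => L y x, ((G y x).card : ℝ) ^ (M - 1) := by
          push_cast
          refine Finset.sum_congr rfl fun x hx => ?_
          rw [card_codes_fix (Finset.mem_filter.1 hx).1 (Finset.filter_subset _ _)]
          push_cast; rfl
      _ ≤ ∑ x ∈ T.filter fun x => L y x,
            (T.card : ℝ) ^ (M - 1) * Real.exp (1 - Real.exp (n * δ)) :=
          Finset.sum_le_sum fun x hx => hG y x (Finset.mem_filter.1 hx).2
      _ ≤ ∑ x ∈ T, (T.card : ℝ) ^ (M - 1) * Real.exp (1 - Real.exp (n * δ)) :=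
          Finset.sum_le_sum_of_subset_of_nonneg (Finset.filter_subset _ _)
            fun _ _ _ => by positivity
      _ = (T.card : ℝ) ^ M * Real.exp (1 - Real.exp (n * δ)) := by
          rw [Finset.sum_const, nsmul_eq_mul, ← mul_assoc, ← pow_succ',
            Nat.sub_add_cancel (codeSize_pos R n)]
  calc _ ≤ (((Finset.univ.biUnion fun y : Fin n → Y => Finset.univ.biUnion fun m : Fin M =>
        (T.filter fun x => L y x).biUnion fun x =>
          (Fintype.piFinset fun _ : Fin M => T).filter
            fun c => c m = x ∧ ∀ j, j ≠ m → c j ∈ G y x).card : ℕ) : ℝ) := by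
        exact_mod_cast Finset.card_le_card hsub
    _ ≤ ∑ y : Fin n → Y, ∑ m : Fin M, ((((T.filter fun x => L y x).biUnion fun x =>
          (Fintype.piFinset fun _ : Fin M => T).filter
            fun c => c m = x ∧ ∀ j, j ≠ m → c j ∈ G y x).card : ℕ) : ℝ) := by
        norm_cast
        exact Finset.card_biUnion_le.trans (Finset.sum_le_sum fun y _ => Finset.card_biUnion_le)
    _ ≤ ∑ y : Fin n → Y, ∑ m : Fin M, (T.card : ℝ) ^ M * Real.exp (1 - Real.exp (n * δ)) :=
        Finset.sum_le_sum fun y _ => Finset.sum_le_sum fun m _ => hcount y m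
    _ = _ := by
        rw [card_codes]
        simp only [Finset.sum_const, Finset.card_univ, Fintype.card_fin, Fintype.card_fun,
          nsmul_eq_mul, Nat.cast_pow]
        ring

/-- The polynomial factor in the random coding bound. -/
def polyFactor (X Y : Type*) [Fintype X] [Fintype Y] (n : ℕ) : ℝ :=
  Real.exp (Fintype.card X * stirlingLoss n) * ((n : ℝ) + 1) ^ (Fintype.card X * Fintype.card Y)

theorem one_le_polyFactor (n : ℕ) : 1 ≤ polyFactor X Y n := by
  unfold polyFactor
  have h1 : 1 ≤ Real.exp (Fintype.card X * stirlingLoss n) :=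
    Real.one_le_exp (mul_nonneg (Nat.cast_nonneg _) (stirlingLoss_nonneg n))
  have h2 : 1 ≤ ((n : ℝ) + 1) ^ (Fintype.card X * Fintype.card Y) :=
    one_le_pow₀ (by simp)
  nlinarith

-- The bound is the minimum of one and the expected number of bad competitors. If `e ≤ D`, counting
-- all codes with `c m = x` is enough. If `e > D`, the transmitted word cannot be its own
-- competitor, and the factor `M ≤ 2 exp (n R)` of the union bound cancels the rate in the
-- probability of each other competitor.
open Classical in
theorem card_errorTriple_le (hn : 0 < n) (W V : X → Y → ℝ) (a : ℝ) {R : ℝ}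
    (hR : 0 ≤ R) (r e : ℝ) (x₀ x : Fin n → X) (hx : x ∈ typeClass x₀) (y : Fin n → Y)
    (hB : ∀ x' ∈ typeClass x₀, IsErrorTriple W V a r x x' y →
      e ≤ divFormula W (typ x y) + max (infoFormula (typ x' y) - R) 0)
    (hA : IsErrorTriple W V a r x x y → e ≤ divFormula W (typ x y)) :
    ∀ m : Fin (codeSize R n), (((Fintype.piFinset fun _ : Fin (codeSize R n) => typeClass x₀).filter fun c =>
        c m = x ∧ ∃ j, IsErrorTriple W V a r x (c j) y).card : ℝ)
      ≤ ((typeClass x₀).card : ℝ) ^ (codeSize R n - 1) * (2 * polyFactor X Y n *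
        Real.exp (n * (divFormula W (typ x y) - e))) := by
  set T := typeClass x₀ with hT
  set M := codeSize R n with hM
  set D := divFormula W (typ x y) with hD
  intro m
  have hK := one_le_polyFactor (X := X) (Y := Y) n
  have hTpos : (0 : ℝ) < T.card := by exact_mod_cast card_typeClass_pos x₀
  have hn' : (0 : ℝ) < n := by exact_mod_cast hn
  rcases le_or_gt e D with hle | hgt
  · have h1 : ((Fintype.piFinset fun _ : Fin M => T).filter fun c =>
        c m = x ∧ ∃ j, IsErrorTriple W V a r x (c j) y).card ≤ T.card ^ (M - 1) := by
      rw [← card_codes_fix hx subset_rfl m]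
      refine Finset.card_le_card fun c hc => ?_
      obtain ⟨h1, h2, -⟩ := Finset.mem_filter.1 hc
      exact Finset.mem_filter.2 ⟨h1, h2, fun j _ => Fintype.mem_piFinset.1 h1 j⟩
    calc _ ≤ (T.card : ℝ) ^ (M - 1) * 1 := by rw [mul_one]; exact_mod_cast h1
      _ ≤ _ := by
        gcongr
        have : 1 ≤ Real.exp (n * (D - e)) :=
          Real.one_le_exp (mul_nonneg hn'.le (by linarith))
        nlinarith
  -- Since `e > D`, the positive part in `hB` must be attained by `I - R`, so each word of `S`
  -- satisfies `I ≥ e - D + R`. Its share of the class is then bounded by averaging `exp (n I)`.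
  · let S := T.filter fun x' => IsErrorTriple W V a r x x' y
    have hS : (S.card : ℝ) ≤ T.card * (polyFactor X Y n * Real.exp (n * (D - e - R))) := by
      calc (S.card : ℝ) = ∑ x' ∈ S, 1 := by simp
        _ ≤ ∑ x' ∈ S, Real.exp (n * infoFormula (typ x' y)) * Real.exp (n * (D - e - R)) := by
            refine Finset.sum_le_sum fun x' hx' => ?_
            obtain ⟨h1, h2⟩ := Finset.mem_filter.1 hx'
            have h3 := hB x' h1 h2
            rw [← Real.exp_add]
            refine Real.one_le_exp ?_
            rw [← mul_add]
            refine mul_nonneg hn'.le ?_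
            rcases le_total (infoFormula (typ x' y) - R) 0 with h4 | h4
            · rw [max_eq_right h4] at h3; linarith
            · rw [max_eq_left h4] at h3; linarith
        _ ≤ ∑ x' ∈ T, Real.exp (n * infoFormula (typ x' y)) * Real.exp (n * (D - e - R)) :=
            Finset.sum_le_sum_of_subset_of_nonneg (Finset.filter_subset _ _)
              fun _ _ _ => by positivity
        _ = (∑ x' ∈ T, Real.exp (n * infoFormula (typ x' y))) * Real.exp (n * (D - e - R)) := by
            rw [Finset.sum_mul]
        _ ≤ (T.card * polyFactor X Y n) * Real.exp (n * (D - e - R)) := by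
            gcongr; exact sum_typeClass_exp_le hn x₀ y
        _ = _ := by ring
    have hpair : ∀ j, j ≠ m → (((Fintype.piFinset fun _ : Fin M => T).filter fun c =>
        c m = x ∧ c j ∈ S).card : ℝ)
        ≤ (T.card : ℝ) ^ (M - 1) * (polyFactor X Y n * Real.exp (n * (D - e - R))) := by
      intro j hj
      have h1 := card_codes_fix_two (M := M) hx (Finset.filter_subset _ _ : S ⊆ T) hj
      have h2 : (T.card : ℝ) * (((Fintype.piFinset fun _ : Fin M => T).filter fun c =>
        c m = x ∧ c j ∈ S).card : ℝ) = (T.card : ℝ) ^ (M - 1) * S.card := by exact_mod_cast h1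
      refine le_of_mul_le_mul_left ?_ hTpos
      rw [h2]
      calc _ ≤ (T.card : ℝ) ^ (M - 1) * (T.card * (polyFactor X Y n *
            Real.exp (n * (D - e - R)))) := by gcongr
        _ = _ := by ring
    have hsub : ((Fintype.piFinset fun _ : Fin M => T).filter fun c =>
        c m = x ∧ ∃ j, IsErrorTriple W V a r x (c j) y) ⊆
        (Finset.univ.erase m).biUnion fun j => (Fintype.piFinset fun _ : Fin M => T).filter
          fun c => c m = x ∧ c j ∈ S := by
      intro c hc
      obtain ⟨h1, h2, j, h3⟩ := Finset.mem_filter.1 hc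
      refine Finset.mem_biUnion.2 ⟨j, Finset.mem_erase.2 ⟨?_, Finset.mem_univ _⟩,
        Finset.mem_filter.2 ⟨h1, h2, Finset.mem_filter.2 ⟨Fintype.mem_piFinset.1 h1 j, h3⟩⟩⟩
      rintro rfl
      rw [h2] at h3
      exact absurd (hA h3) (not_le.2 hgt)
    calc _ ≤ ∑ j ∈ Finset.univ.erase m, (((Fintype.piFinset fun _ : Fin M => T).filter fun c =>
          c m = x ∧ c j ∈ S).card : ℝ) := by
          exact_mod_cast (Finset.card_le_card hsub).trans Finset.card_biUnion_le
      _ ≤ ∑ j ∈ Finset.univ.erase m,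
          (T.card : ℝ) ^ (M - 1) * (polyFactor X Y n * Real.exp (n * (D - e - R))) :=
          Finset.sum_le_sum fun j hj => hpair j (Finset.ne_of_mem_erase hj)
      _ ≤ ∑ _j : Fin M,
          (T.card : ℝ) ^ (M - 1) * (polyFactor X Y n * Real.exp (n * (D - e - R))) :=
          Finset.sum_le_sum_of_subset_of_nonneg (Finset.erase_subset _ _)
            fun _ _ _ => by positivity
      _ = M * ((T.card : ℝ) ^ (M - 1) * (polyFactor X Y n * Real.exp (n * (D - e - R)))) := by
          simp
      _ ≤ (2 * Real.exp (n * R)) *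
          ((T.card : ℝ) ^ (M - 1) * (polyFactor X Y n * Real.exp (n * (D - e - R)))) := by
          gcongr; exact codeSize_le hR n
      _ = (T.card : ℝ) ^ (M - 1) * (2 * polyFactor X Y n *
          (Real.exp (n * R) * Real.exp (n * (D - e - R)))) := by ring
      _ = _ := by
          rw [← Real.exp_add]; congr 3; ring

/-- Conditioning on the transmitted word and the output, the fraction of bad codes is `exp (n (D -
e))` up to a polynomial. The factor `exp (n D)` is paid for by `W(y|x)`, whose sum against it is
polynomial. -/
theorem sum_tripleProb_le (hn : 0 < n) {W : X → Y → ℝ} (hW : ∀ a b, 0 ≤ W a b) (V : X → Y → ℝ)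
    (a : ℝ) {R : ℝ} (hR : 0 ≤ R) (r e : ℝ) (x₀ : Fin n → X)
    (hB : ∀ x ∈ typeClass x₀, ∀ x' ∈ typeClass x₀, ∀ y, blockProb W x y ≠ 0 →
      IsErrorTriple W V a r x x' y →
      e ≤ divFormula W (typ x y) + max (infoFormula (typ x' y) - R) 0)
    (hA : ∀ x ∈ typeClass x₀, ∀ y, blockProb W x y ≠ 0 → IsErrorTriple W V a r x x y →
      e ≤ divFormula W (typ x y)) :
    ∑ c ∈ Fintype.piFinset fun _ : Fin (codeSize R n) => typeClass x₀, tripleProb W V a r c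
      ≤ (Fintype.piFinset fun _ : Fin (codeSize R n) => typeClass x₀).card *
        (2 * polyFactor X Y n * ((n : ℝ) + 1) ^ (Fintype.card X * Fintype.card Y)
          * Real.exp (-(n * e))) := by
  classical
  set T := typeClass x₀ with hT
  set M := codeSize R n with hM
  set K := polyFactor X Y n with hK
  set N := ((n : ℝ) + 1) ^ (Fintype.card X * Fintype.card Y) with hN
  have hKpos : 0 < K := one_pos.trans_le (one_le_polyFactor n)
  have hmsg : ∀ m : Fin M, ∑ c ∈ Fintype.piFinset fun _ : Fin M => T, ∑ y,
      (if ∃ j, IsErrorTriple W V a r (c m) (c j) y then blockProb W (c m) y else 0)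
      ≤ (T.card : ℝ) ^ M * (2 * K * N * Real.exp (-(n * e))) := by
    intro m
    calc _ = ∑ x ∈ T, ∑ c ∈ (Fintype.piFinset fun _ : Fin M => T).filter fun c => c m = x, ∑ y,
          (if ∃ j, IsErrorTriple W V a r (c m) (c j) y then blockProb W (c m) y else 0) :=
          (Finset.sum_fiberwise_of_maps_to (fun c hc => Fintype.mem_piFinset.1 hc m) _).symm
      _ = ∑ x ∈ T, ∑ y, (((Fintype.piFinset fun _ : Fin M => T).filter fun c =>
            c m = x ∧ ∃ j, IsErrorTriple W V a r x (c j) y).card : ℝ) * blockProb W x y := by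
          refine Finset.sum_congr rfl fun x _ => ?_
          rw [Finset.sum_comm]
          refine Finset.sum_congr rfl fun y _ => ?_
          rw [← Finset.filter_filter, ← nsmul_eq_mul, ← Finset.sum_const, Finset.sum_filter (s :=
            (Fintype.piFinset fun _ : Fin M => T).filter fun c => c m = x)]
          refine Finset.sum_congr rfl fun c hc => ?_
          rw [(Finset.mem_filter.1 hc).2]
      _ ≤ ∑ x ∈ T, ∑ y, ((T.card : ℝ) ^ (M - 1) * (2 * K * Real.exp (-(n * e)))) *
            (blockProb W x y * Real.exp (n * divFormula W (typ x y))) := by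
          refine Finset.sum_le_sum fun x hx => Finset.sum_le_sum fun y _ => ?_
          by_cases h0 : blockProb W x y = 0
          · simp [h0]
          · have h1 := card_errorTriple_le hn W V a hR r e x₀ x hx y
              (fun x' hx' => hB x hx x' hx' y h0) (hA x hx y h0) m
            calc _ ≤ ((T.card : ℝ) ^ (M - 1) * (2 * K *
                  Real.exp (n * (divFormula W (typ x y) - e)))) * blockProb W x y := by
                  gcongr
                  exact blockProb_nonneg hW x y
              _ = _ := by
                  rw [mul_sub, sub_eq_add_neg, Real.exp_add]; ring
      _ = ∑ x ∈ T, ((T.card : ℝ) ^ (M - 1) * (2 * K * Real.exp (-(n * e)))) *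
            ∑ y, blockProb W x y * Real.exp (n * divFormula W (typ x y)) := by
          simp only [Finset.mul_sum]
      _ ≤ ∑ x ∈ T, ((T.card : ℝ) ^ (M - 1) * (2 * K * Real.exp (-(n * e)))) * N := by
          gcongr with x hx
          exact sum_blockProb_mul_exp_le hn hW x
      _ = (T.card : ℝ) ^ M * (2 * K * N * Real.exp (-(n * e))) := by
          rw [Finset.sum_const, nsmul_eq_mul]
          have : (T.card : ℝ) ^ M = T.card * (T.card : ℝ) ^ (M - 1) := by
            rw [← pow_succ', Nat.sub_add_cancel (codeSize_pos R n)]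
          rw [this]; ring
  have hMpos : (0 : ℝ) < M := by exact_mod_cast codeSize_pos R n
  calc _ = (1 / (M : ℝ)) * ∑ m, ∑ c ∈ Fintype.piFinset fun _ : Fin M => T, ∑ y,
      (if ∃ j, IsErrorTriple W V a r (c m) (c j) y then blockProb W (c m) y else 0) := by
        simp only [tripleProb]
        rw [← Finset.mul_sum, Finset.sum_comm]
    _ ≤ (1 / (M : ℝ)) * ∑ _m : Fin M, (T.card : ℝ) ^ M * (2 * K * N * Real.exp (-(n * e))) := by
        gcongr with m _
        exact hmsg m
    _ = _ := by
        rw [card_codes]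
        simp only [Finset.sum_const, Finset.card_univ, Fintype.card_fin, nsmul_eq_mul,
          Nat.cast_pow]
        field_simp

end RandomCoding

/-! ### Normalized exponents and their monotonicity. -/

section Exponents

theorem ereal_sub_coe_sub_coe (E : EReal) (s t : ℝ) :
    E - (s : EReal) - (t : EReal) = E - ((s + t : ℝ) : EReal) := by
  induction E with
  | bot => simp
  | top => rw [EReal.top_sub_coe, EReal.top_sub_coe, EReal.top_sub_coe]
  | coe e =>
    rw [← EReal.coe_sub, ← EReal.coe_sub, ← EReal.coe_sub]
    congr 1; ring

theorem ereal_sub_coe_le_sub_coe (E : EReal) {s t : ℝ} (h : s ≤ t) :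
    E - (t : EReal) ≤ E - (s : EReal) :=
  EReal.sub_le_sub le_rfl (EReal.coe_le_coe_iff.2 h)

/-- `-(1/n) log p`, with `-log 0 = ∞`. -/
def normExponent (n : ℕ) (p : ℝ) : EReal :=
  if p = 0 then ⊤ else ((-(1 / (n : ℝ)) * Real.log p : ℝ) : EReal)

theorem normExponent_anti {n : ℕ} {p q : ℝ} (hp : 0 ≤ p) (h : p ≤ q) :
    normExponent n q ≤ normExponent n p := by
  unfold normExponent
  rcases hp.eq_or_lt with h0 | h0
  · rw [if_pos h0.symm]; exact le_top
  · rw [if_neg h0.ne', if_neg (h0.trans_le h).ne', EReal.coe_le_coe_iff, neg_mul, neg_mul,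
      neg_le_neg_iff]
    gcongr

theorem le_normExponent {n : ℕ} (hn : 0 < n) {p t : ℝ} (hp : 0 ≤ p)
    (h : p ≤ Real.exp (-(n * t))) : (t : EReal) ≤ normExponent n p := by
  refine le_trans ?_ (normExponent_anti hp h)
  rw [normExponent, if_neg (Real.exp_pos _).ne', Real.log_exp, EReal.coe_le_coe_iff]
  have : (n : ℝ) ≠ 0 := by positivity
  field_simp
  exact le_rfl

section Monotone

variable {X Y : Type*} [Fintype X] [Fintype Y]

theorem tL_anti {a a' : ℝ} (h : a ≤ a') (P : X → ℝ) (W : X → Y → ℝ) (q : Y → ℝ) (γ : EReal) :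
    tL a' P W q γ ≤ tL a P W q γ := by
  refine le_iInf₂ fun Q hQ => iInf₂_le Q ⟨hQ.1, hQ.2.1, hQ.2.2.1, ?_⟩
  refine le_trans ?_ hQ.2.2.2
  gcongr
  exact EReal.sub_le_sub (EReal.neg_le_neg_iff.2 (EReal.coe_le_coe_iff.2 h)) le_rfl

theorem domA_subset {r r' a a' : ℝ} (hr : r ≤ r') (ha : a ≤ a') (P : X → ℝ) (W V : X → Y → ℝ) :
    domA r' a' P W V ⊆ domA r a P W V := by
  intro Q hQ
  refine ⟨hQ.1, hQ.2.1.trans ?_, ?_⟩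
  · gcongr
    exact EReal.neg_le_neg_iff.2 (EReal.coe_le_coe_iff.2 ha)
  · exact (EReal.coe_le_coe_iff.2 hr).trans (hQ.2.2.trans (tL_anti ha _ _ _ _))

theorem domB_subset {r r' a a' : ℝ} (hr : r ≤ r') (ha : a ≤ a') (P : X → ℝ) (W V : X → Y → ℝ) :
    domB r' a' P W V ⊆ domB r a P W V := by
  intro Q hQ
  refine ⟨hQ.1, hQ.2.1, hQ.2.2.1, hQ.2.2.2.1.trans ?_, le_trans ?_ hQ.2.2.2.2.1, ?_⟩
  · gcongr
    exact EReal.neg_le_neg_iff.2 (EReal.coe_le_coe_iff.2 ha)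
  · gcongr
  · exact (EReal.coe_le_coe_iff.2 hr).trans (hQ.2.2.2.2.2.trans (tL_anti ha _ _ _ _))

/-- Both feasible sets shrink as the parameters grow. Only the term `[I - r]_+` moves the other way,
with slope at most one in `r`, and this is the whole loss. -/
theorem expRC_sub_le {r r' a a' : ℝ} (hr : r ≤ r') (ha : a ≤ a') (P : X → ℝ) (W V : X → Y → ℝ) :
    expRC r a P W V - ((r' - r : ℝ) : EReal) ≤ expRC r' a' P W V := by
  refine le_min ?_ ?_
  · calc expRC r a P W V - ((r' - r : ℝ) : EReal) ≤ expRC r a P W V - ((0 : ℝ) : EReal) :=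
          ereal_sub_coe_le_sub_coe _ (by linarith)
      _ = expRC r a P W V := by simp
      _ ≤ expA r a P W V := min_le_left _ _
      _ ≤ expA r' a' P W V := biInf_mono (domA_subset hr ha P W V)
  · refine le_iInf₂ fun Q hQ => EReal.sub_le_of_le_add ?_
    refine (min_le_right _ _).trans ((iInf₂_le Q (domB_subset hr ha P W V hQ)).trans ?_)
    rw [add_assoc, ← EReal.coe_add]
    gcongr
    refine max_le ?_ ?_
    · linarith [le_max_left (mutualInfo Q.2 - r') 0]
    · linarith [le_max_right (mutualInfo Q.2 - r') 0]

end Monotone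

/-! ### Selection of one code for both error probabilities. -/

section Ensemble

variable {X Y : Type*} [Fintype X] [Fintype Y] [DecidableEq X]

/-- Every distribution is approximated by types of words, uniformly in the blocklength. -/
theorem exists_words_approx {P : X → ℝ} (hP : P ∈ stdSimplex ℝ X) :
    ∃ x : (n : ℕ) → Fin n → X, (∀ n s, P s = 0 → cnt (x n) s = 0) ∧
      Tendsto (fun n => dist (fun s => (cnt (x n) s : ℝ) / n) P) atTop (𝓝 0) := by
  obtain ⟨s₁, hs₁⟩ : ∃ s, P s ≠ 0 := by
    by_contra! h
    have := hP.2
    simp [h] at this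
  have hfl : ∀ n : ℕ, ∑ s, ⌊n * P s⌋₊ ≤ n := by
    intro n
    have : (∑ s, (⌊n * P s⌋₊ : ℝ)) ≤ ∑ s, n * P s :=
      Finset.sum_le_sum fun s _ => Nat.floor_le (mul_nonneg (Nat.cast_nonneg _) (hP.1 s))
    rw [← Finset.mul_sum, hP.2, mul_one] at this
    exact_mod_cast this
  -- The rounding deficit goes to a symbol of nonzero probability, so the support stays inside that
  -- of `P`.
  let N : ℕ → X → ℕ := fun n s => ⌊n * P s⌋₊ + if s = s₁ then n - ∑ s, ⌊n * P s⌋₊ else 0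
  have hN : ∀ n, ∑ s, N n s = n := fun n => by
    simp only [N, Finset.sum_add_distrib, Finset.sum_ite_eq', Finset.mem_univ, if_true]
    have := hfl n
    omega
  have hex : ∀ n, ∃ x : Fin n → X, ∀ s, cnt x s = N n s := by
    intro n
    obtain ⟨x, hx⟩ := exists_word_of_cnt (fun _ : Fin n => ()) (fun s _ => N n s)
      fun b => by rw [hN]; simp [cnt]
    refine ⟨x, fun s => ?_⟩
    rw [← hx s ()]
    simp [cnt, pair]
  choose x hx using hex
  refine ⟨x, fun n s hs => ?_, ?_⟩
  · rw [hx]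
    have : s ≠ s₁ := fun h => hs₁ (h ▸ hs)
    simp [N, hs, this]
  · have hlim : Tendsto (fun n : ℕ => (Fintype.card X : ℝ) / n) atTop (𝓝 0) :=
      tendsto_const_div_atTop_nhds_zero_nat _
    refine squeeze_zero' (Eventually.of_forall fun n => dist_nonneg) ?_ hlim
    filter_upwards [eventually_gt_atTop 0] with n hn
    have hn' : (0 : ℝ) < n := by exact_mod_cast hn
    refine (dist_pi_le_iff (by positivity)).2 fun s => ?_
    rw [Real.dist_eq, hx]
    have e : (N n s : ℝ) / n - P s = (N n s - n * P s) / n := by field_simp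
    rw [e, abs_div, abs_of_pos hn']
    gcongr
    have hlt : ∀ s, n * P s - 1 < (⌊n * P s⌋₊ : ℝ) := fun s => Nat.sub_one_lt_floor _
    have hle : (⌊n * P s⌋₊ : ℝ) ≤ n * P s :=
      Nat.floor_le (mul_nonneg hn'.le (hP.1 s))
    have hcard : (1 : ℝ) ≤ Fintype.card X := by
      exact_mod_cast Fintype.card_pos_iff.2 ⟨s₁⟩
    have hrem : (n : ℝ) - ∑ s, (⌊n * P s⌋₊ : ℝ) ≤ Fintype.card X := by
      have : ∑ s, (n * P s - 1) ≤ ∑ s, (⌊n * P s⌋₊ : ℝ) :=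
        Finset.sum_le_sum fun s _ => (hlt s).le
      rw [Finset.sum_sub_distrib, ← Finset.mul_sum, hP.2] at this
      simp at this
      linarith
    have hNs : (N n s : ℝ) = (⌊n * P s⌋₊ : ℝ)
        + if s = s₁ then (n : ℝ) - ∑ s, (⌊n * P s⌋₊ : ℝ) else 0 := by
      simp only [N]
      push_cast [Nat.cast_sub (hfl n)]
      rfl
    have hrem0 : 0 ≤ (n : ℝ) - ∑ s, (⌊n * P s⌋₊ : ℝ) := by
      rw [sub_nonneg]; exact_mod_cast hfl n
    rw [hNs, abs_le]
    split_ifs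
    · constructor <;> linarith [hlt s]
    · constructor <;> linarith [hlt s]

theorem eventually_atypical_small (Y : Type*) [Fintype Y] {R : ℝ} (hR : 0 ≤ R) {δ : ℝ}
    (hδ : 0 < δ) :
    ∀ᶠ n : ℕ in atTop, (Fintype.card Y : ℝ) ^ n * codeSize R n * Real.exp (1 - Real.exp (n * δ))
      ≤ 1 / 8 := by
  set B := (Fintype.card Y : ℝ) with hB
  -- The threshold ensures `(n δ)² / 2 ≥ n (B + R + 4)`, so the quadratic lower bound for `exp (n
  -- δ)` alone leaves a total exponent at most `-3`.
  filter_upwards [eventually_ge_atTop 1,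
    tendsto_natCast_atTop_atTop.eventually_ge_atTop ((B + R + 4) * 2 / δ ^ 2)] with n hn1 hn2
  have hn1' : (1 : ℝ) ≤ n := by exact_mod_cast hn1
  rw [div_le_iff₀ (by positivity)] at hn2
  have h1 : B ^ n ≤ Real.exp (n * B) := by
    rw [Real.exp_nat_mul]
    gcongr
    linarith [Real.add_one_le_exp B]
  have h2 := Real.quadratic_le_exp_of_nonneg (x := n * δ) (by positivity)
  calc _ ≤ Real.exp (n * B) * (2 * Real.exp (n * R)) * Real.exp (1 - Real.exp (n * δ)) := by
        gcongr
        exact codeSize_le hR n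
    _ = 2 * Real.exp (n * B + n * R + (1 - Real.exp (n * δ))) := by
        rw [Real.exp_add, Real.exp_add]; ring
    _ ≤ 2 * Real.exp (-3) := by
        gcongr
        have h3 : 0 ≤ n * δ := by positivity
        have h4 : (n : ℝ) * ((B + R + 4) * 2) ≤ n * (n * δ ^ 2) := by gcongr
        nlinarith
    _ ≤ 1 / 8 := by
        rw [Real.exp_neg, ← div_eq_mul_inv, div_le_div_iff₀ (Real.exp_pos _) (by norm_num)]
        have h5 : Real.exp 3 = Real.exp 1 ^ 3 := by rw [← Real.exp_nat_mul]; norm_num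
        have h6 := Real.exp_one_gt_d9
        have h7 : (2.7 : ℝ) ^ 3 ≤ Real.exp 1 ^ 3 := by gcongr; linarith
        rw [h5]
        norm_num at h7 ⊢
        linarith

/-- The constant `16` combines the factor `8` in the penalty with the factor `2` in the bound on the
code size. -/
theorem polyFactor_bound (X Y : Type*) [Fintype X] [Fintype Y] (n : ℕ) :
    16 * polyFactor X Y n * ((n : ℝ) + 1) ^ (Fintype.card X * Fintype.card Y)
      ≤ Real.exp ((3 + Fintype.card X + 2 * (Fintype.card X * Fintype.card Y)) * stirlingLoss n) := by
  have hl : 1 ≤ stirlingLoss n := by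
    have : 0 ≤ Real.log ((n : ℝ) + 1) := Real.log_nonneg (by simp)
    unfold stirlingLoss; linarith
  have h1 : ((n : ℝ) + 1) ^ (Fintype.card X * Fintype.card Y)
      ≤ Real.exp ((Fintype.card X * Fintype.card Y) * stirlingLoss n) := by
    rw [← Nat.cast_mul, Real.exp_nat_mul]
    gcongr
    calc (n : ℝ) + 1 = Real.exp (Real.log ((n : ℝ) + 1)) := (Real.exp_log (by positivity)).symm
      _ ≤ _ := Real.exp_le_exp.2 (by unfold stirlingLoss; linarith)
  have h2 : (16 : ℝ) ≤ Real.exp (3 * stirlingLoss n) := by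
    have h5 : Real.exp 3 = Real.exp 1 ^ 3 := by rw [← Real.exp_nat_mul]; norm_num
    have h6 := Real.exp_one_gt_d9
    have h7 : (2.7 : ℝ) ^ 3 ≤ Real.exp 1 ^ 3 := by gcongr; linarith
    calc (16 : ℝ) ≤ Real.exp 3 := by rw [h5]; norm_num at h7 ⊢; linarith
      _ ≤ _ := Real.exp_le_exp.2 (by linarith)
  calc _ ≤ Real.exp (3 * stirlingLoss n) * (Real.exp (Fintype.card X * stirlingLoss n) *
        Real.exp ((Fintype.card X * Fintype.card Y) * stirlingLoss n)) *
        Real.exp ((Fintype.card X * Fintype.card Y) * stirlingLoss n) := by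
        unfold polyFactor
        gcongr
    _ = _ := by
        rw [← Real.exp_add, ← Real.exp_add, ← Real.exp_add]; congr 1; ring

variable [DecidableEq Y]

theorem tripleProb_nonneg {n M : ℕ} {W : X → Y → ℝ} (hW : ∀ a b, 0 ≤ W a b) (V : X → Y → ℝ)
    (a r : ℝ) (c : Codebook X M n) : 0 ≤ tripleProb W V a r c := by
  unfold tripleProb
  refine mul_nonneg (by positivity) (Finset.sum_nonneg fun m _ => Finset.sum_nonneg fun y _ => ?_)
  split_ifs
  exacts [blockProb_nonneg hW _ _, le_rfl]

open Classical in
/-- For one of the two error probabilities, codebooks from the constant composition ensemble with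
small penalty achieve the exponent, and the average penalty is small. -/
theorem exists_penalty {W V : X → Y → ℝ} (hW : ∀ a b, 0 ≤ W a b) (hV : ∀ a b, 0 ≤ V a b)
    {P : X → ℝ} (hP : P ∈ stdSimplex ℝ X) {R : ℝ} (hR : 0 ≤ R) (a : ℝ) {δ : ℝ} (hδ : 0 < δ) :
    ∃ η > 0, ∀ᶠ n : ℕ in atTop, ∀ x₀ : Fin n → X, (∀ s, P s = 0 → cnt x₀ s = 0) →
      dist (fun s => (cnt x₀ s : ℝ) / n) P ≤ η →
      ∃ Φ : Codebook X (codeSize R n) n → ℝ, (∀ c, 0 ≤ Φ c) ∧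
        ∑ c ∈ Fintype.piFinset (fun _ : Fin (codeSize R n) => typeClass x₀), Φ c
          ≤ (Fintype.piFinset fun _ : Fin (codeSize R n) => typeClass x₀).card * (1 / 4) ∧
        ∀ c ∈ Fintype.piFinset (fun _ : Fin (codeSize R n) => typeClass x₀), Φ c < 1 →
          expRC (R - δ) (a - δ) P W V - ((3 * δ : ℝ) : EReal)
            ≤ normExponent n (outputProb W c (dominanceRegion W V a c)) := by
  obtain ⟨η, hη, hbad⟩ := exponents_le_of_isErrorTriple hW hV hP R a hδ
  refine ⟨η, hη, ?_⟩
  filter_upwards [hbad, eventually_gt_atTop 0, eventually_atypical_small Y hR (half_pos hδ),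
    eventually_mul_stirlingLoss_le
      (3 + Fintype.card X + 2 * (Fintype.card X * Fintype.card Y)) hδ]
    with n hbad hn hsmall hst x₀ hx₀ hd
  have hn' : (0 : ℝ) < n := by exact_mod_cast hn
  set r := R - δ / 2 with hr
  set T := typeClass x₀ with hT
  set E := expRC (R - δ) (a - δ) P W V with hE
  have hcnt : ∀ x ∈ T, cnt x = cnt x₀ := fun x hx => mem_typeClass.1 hx
  have hB : ∀ x ∈ T, ∀ x' ∈ T, ∀ y, blockProb W x y ≠ 0 → IsErrorTriple W V a r x x' y →
      E ≤ ((divFormula W (typ x y) + max (infoFormula (typ x' y) - R) 0 + 2 * δ : ℝ) : EReal) :=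
    fun x hx x' hx' y h0 ht => (min_le_right _ _).trans
      (hbad x x' y (by rw [hcnt x hx, hcnt x' hx']) (by rwa [hcnt x hx]) (by rwa [hcnt x hx])
        h0 ht).1
  have hA : ∀ x ∈ T, ∀ y, blockProb W x y ≠ 0 → IsErrorTriple W V a r x x y →
      E ≤ ((divFormula W (typ x y) + 2 * δ : ℝ) : EReal) :=
    fun x hx y h0 ht => (min_le_left _ _).trans
      ((hbad x x y rfl (by rwa [hcnt x hx]) (by rwa [hcnt x hx]) h0 ht).2 rfl)
  have hatyp : ∑ c ∈ Fintype.piFinset (fun _ : Fin (codeSize R n) => T),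
      (if IsAtypical W V a r c then (1 : ℝ) else 0)
      ≤ (Fintype.piFinset fun _ : Fin (codeSize R n) => T).card * (1 / 8) := by
    rw [← Finset.sum_filter, Finset.sum_const, nsmul_eq_mul, mul_one]
    refine (card_isAtypical_le W V a (δ / 2) x₀).trans ?_
    gcongr
  have hle : ∀ c ∈ Fintype.piFinset (fun _ : Fin (codeSize R n) => T), ∀ s : ℝ, 0 ≤ s →
      (if IsAtypical W V a r c then (1 : ℝ) else 0) + s < 1 → ¬ IsAtypical W V a r c := by
    intro c _ s hs h hat
    rw [if_pos hat] at h
    linarith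
  induction hEc : E with
  | bot =>
    refine ⟨fun _ => 0, fun _ => le_rfl, ?_, fun c _ _ => ?_⟩
    · rw [Finset.sum_const_zero]; positivity
    · rw [EReal.bot_sub]; exact bot_le
  | top =>
    -- An infinite exponent means that no error triple of positive probability exists, so the error
    -- of a non-atypical code is exactly zero.
    refine ⟨fun c => if IsAtypical W V a r c then (1 : ℝ) else 0, fun c => by positivity,
      hatyp.trans (by gcongr; norm_num), fun c hc hlt => ?_⟩
    have hat := hle c hc 0 le_rfl (by simpa using hlt)
    have h1 := outputProb_le_tripleProb hW V a r hat
    have h2 : tripleProb W V a r c = 0 := by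
      unfold tripleProb
      rw [Finset.sum_eq_zero, mul_zero]
      refine fun m _ => Finset.sum_eq_zero fun y _ => ?_
      split_ifs with hex
      · obtain ⟨j, hj⟩ := hex
        by_contra h0
        have hm := Fintype.mem_piFinset.1 hc
        have := hB _ (hm m) _ (hm j) y h0 hj
        rw [hEc, top_le_iff] at this
        exact EReal.coe_ne_top _ this
      · rfl
    have h3 : outputProb W c (dominanceRegion W V a c) = 0 :=
      le_antisymm (h1.trans h2.le) (outputProb_nonneg hW c _)
    rw [normExponent, if_pos h3]
    exact le_top
  | coe e₀ =>
    rw [hEc] at hB hA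
    set b := 2 * polyFactor X Y n * ((n : ℝ) + 1) ^ (Fintype.card X * Fintype.card Y)
      * Real.exp (-(n * (e₀ - 2 * δ))) with hb
    have hb0 : 0 < b := by
      have := one_pos.trans_le (one_le_polyFactor (X := X) (Y := Y) n)
      positivity
    have hmain := sum_tripleProb_le hn hW V a hR r (e₀ - 2 * δ) x₀
      (fun x hx x' hx' y h0 ht => by
        have := EReal.coe_le_coe_iff.1 (hB x hx x' hx' y h0 ht); linarith)
      (fun x hx y h0 ht => by
        have := EReal.coe_le_coe_iff.1 (hA x hx y h0 ht); linarith)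
    -- A penalty below one excludes atypicality and bounds the triple probability by `8 b`. Each
    -- summand has mean at most `1 / 8`, hence the mean `1 / 4`.
    refine ⟨fun c => (if IsAtypical W V a r c then (1 : ℝ) else 0)
      + tripleProb W V a r c / (8 * b), fun c => ?_, ?_, fun c hc hlt => ?_⟩
    · have := tripleProb_nonneg hW V a r c
      positivity
    · rw [Finset.sum_add_distrib, ← Finset.sum_div]
      have : (∑ c ∈ Fintype.piFinset (fun _ : Fin (codeSize R n) => T), tripleProb W V a r c)
          / (8 * b) ≤ (Fintype.piFinset fun _ : Fin (codeSize R n) => T).card * (1 / 8) := by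
        rw [div_le_iff₀ (by positivity)]
        refine hmain.trans (le_of_eq ?_)
        rw [← hb]; ring
      linarith
    · have hs : 0 ≤ tripleProb W V a r c / (8 * b) :=
        div_nonneg (tripleProb_nonneg hW V a r c) (by positivity)
      have hat := hle c hc _ hs hlt
      beta_reduce at hlt
      rw [if_neg hat, zero_add, div_lt_one (by positivity)] at hlt
      rw [← EReal.coe_sub]
      refine le_normExponent hn (outputProb_nonneg hW c _) ?_
      refine (outputProb_le_tripleProb hW V a r hat).trans (hlt.le.trans ?_)
      calc 8 * b = 16 * polyFactor X Y n * ((n : ℝ) + 1) ^ (Fintype.card X * Fintype.card Y)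
            * Real.exp (-(n * (e₀ - 2 * δ))) := by rw [hb]; ring
        _ ≤ Real.exp ((3 + Fintype.card X + 2 * (Fintype.card X * Fintype.card Y))
              * stirlingLoss n) * Real.exp (-(n * (e₀ - 2 * δ))) := by
            gcongr
            exact polyFactor_bound X Y n
        _ ≤ Real.exp (n * δ) * Real.exp (-(n * (e₀ - 2 * δ))) := by gcongr
        _ = _ := by rw [← Real.exp_add]; congr 1; ring

/-- Both penalties live on the same ensemble, and the mean of their sum is at most `1 / 2`. Some
code therefore keeps both below one. -/
theorem eventually_exists_code {W V : X → Y → ℝ} (hW : ∀ a b, 0 ≤ W a b) (hV : ∀ a b, 0 ≤ V a b)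
    {P : X → ℝ} (hP : P ∈ stdSimplex ℝ X) {R : ℝ} (hR : 0 ≤ R) (α : ℝ) {δ : ℝ} (hδ : 0 < δ) :
    ∀ᶠ n : ℕ in atTop, ∃ c : Codebook X (codeSize R n) n,
      expRC (R - δ) (α - δ) P W V - ((3 * δ : ℝ) : EReal)
        ≤ normExponent n (probFA W c (rejectL W V α c)) ∧
      expRC (R - δ) (-α - δ) P V W - ((3 * δ : ℝ) : EReal)
        ≤ normExponent n (probMD V c (rejectL W V α c)) := by
  obtain ⟨x, hx0, hx⟩ := exists_words_approx hP
  obtain ⟨η₁, hη₁, h1⟩ := exists_penalty hW hV hP hR α hδ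
  obtain ⟨η₂, hη₂, h2⟩ := exists_penalty hV hW hP hR (-α) hδ
  filter_upwards [h1, h2, hx.eventually_lt_const hη₁, hx.eventually_lt_const hη₂]
    with n h1 h2 hd1 hd2
  obtain ⟨Φ₁, hΦ₁, hs1, hc1⟩ := h1 (x n) (hx0 n) hd1.le
  obtain ⟨Φ₂, hΦ₂, hs2, hc2⟩ := h2 (x n) (hx0 n) hd2.le
  set C := Fintype.piFinset fun _ : Fin (codeSize R n) => typeClass (x n) with hC
  have hCpos : (0 : ℝ) < C.card := by
    rw [hC, card_codes]
    exact_mod_cast pow_pos (card_typeClass_pos (x n)) _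
  obtain ⟨c, hc, hlt⟩ : ∃ c ∈ C, Φ₁ c + Φ₂ c < 1 := by
    refine Finset.exists_lt_of_sum_lt (s := C) (g := fun _ => (1 : ℝ)) ?_
    rw [Finset.sum_add_distrib, Finset.sum_const, nsmul_eq_mul, mul_one]
    linarith
  have hM := codeSize_pos R n
  refine ⟨c, (hc1 c hc (by linarith [hΦ₂ c])).trans ?_, (hc2 c hc (by linarith [hΦ₁ c])).trans ?_⟩
  · exact normExponent_anti (outputProb_nonneg hW c _)
      (outputProb_mono hW c (rejectL_subset hM W V α c))
  · exact normExponent_anti (outputProb_nonneg hV c _)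
      (outputProb_mono hV c (compl_rejectL_subset hM W V α c))

end Ensemble

/-- A sequence meeting eventually each of a decreasing sequence of requirements. -/
theorem exists_diagonal {A : ℕ → Type*} [∀ n, Nonempty (A n)] {G : ℕ → (n : ℕ) → A n → Prop}
    (hG : ∀ k l n c, k ≤ l → G l n c → G k n c) (h : ∀ k, ∀ᶠ n in atTop, ∃ c, G k n c) :
    ∃ C : (n : ℕ) → A n, ∀ k, ∀ᶠ n in atTop, G k n (C n) := by
  classical
  -- At blocklength `n` the strongest satisfiable requirement of index at most `n` is met; it
  -- eventually passes any fixed `k`.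
  let κ : ℕ → ℕ := fun n => Nat.findGreatest (fun k => ∃ c, G k n c) n
  refine ⟨fun n => if hc : ∃ c, G (κ n) n c then hc.choose else Classical.arbitrary _, fun k => ?_⟩
  filter_upwards [h k, eventually_ge_atTop k] with n hn hk
  have h1 : ∃ c, G (κ n) n c := Nat.findGreatest_spec (P := fun k => ∃ c, G k n c) hk hn
  have h2 : k ≤ κ n := Nat.le_findGreatest hk hn
  rw [dif_pos h1]
  exact hG k _ n _ h2 h1.choose_spec

/-! ### Letting the slack tend to zero. -/

section Limits

variable {X Y : Type*} [Fintype X] [Fintype Y]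

/-- Going from slack `u k` to slack `δ` costs `δ - u k` by `expRC_sub_le`. Together with `3 u k` the
loss is `δ + 2 u k`, which tends to `δ`. -/
theorem expRC_sub_le_of_forall {P : X → ℝ} {W V : X → Y → ℝ} {R a : ℝ} {E : EReal} {u : ℕ → ℝ}
    (hu : Tendsto u atTop (𝓝 0))
    (h : ∀ k, expRC (R - u k) (a - u k) P W V - ((3 * u k : ℝ) : EReal) ≤ E) {δ : ℝ} (hδ : 0 < δ) :
    expRC (R - δ) (a - δ) P W V - (δ : EReal) ≤ E := by
  rw [← EReal.ge_of_forall_gt_iff_ge]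
  intro z hz
  have key : ∀ᶠ k in atTop, expRC (R - δ) (a - δ) P W V - ((δ + 2 * u k : ℝ) : EReal) ≤ E := by
    filter_upwards [hu.eventually_lt_const hδ] with k hk
    refine le_trans ?_ (h k)
    have h1 := expRC_sub_le (r := R - δ) (r' := R - u k) (a := a - δ) (a' := a - u k)
      (by linarith) (by linarith) P W V
    refine le_trans (le_of_eq ?_) (EReal.sub_le_sub h1 le_rfl)
    rw [ereal_sub_coe_sub_coe]
    congr 2; ring
  revert hz key
  generalize expRC (R - δ) (a - δ) P W V = F
  intro hz key
  induction F with
  | bot => simp at hz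
  | top =>
    obtain ⟨k, hk⟩ := key.exists
    rw [EReal.top_sub_coe, top_le_iff] at hk
    rw [hk]; exact le_top
  | coe f =>
    rw [← EReal.coe_sub, EReal.coe_lt_coe_iff] at hz
    obtain ⟨k, hk, hk'⟩ := (key.and (hu.eventually_lt_const
      (show 0 < (f - δ - z) / 2 by linarith))).exists
    refine le_trans ?_ hk
    rw [← EReal.coe_sub, EReal.coe_le_coe_iff]
    linarith

/-- The point is approached along the diagonal `(R - δ, a - δ)`, where lower semicontinuity keeps
the exponent above any smaller value. -/
theorem expRC_le_of_lowerSemicontinuousAt {P : X → ℝ} {W V : X → Y → ℝ} {R a : ℝ} {E : EReal}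
    (hl : LowerSemicontinuousAt (fun p : ℝ × ℝ => expRC p.1 p.2 P W V) (R, a))
    (h : ∀ δ : ℝ, 0 < δ → expRC (R - δ) (a - δ) P W V - (δ : EReal) ≤ E) :
    expRC R a P W V ≤ E := by
  rw [← EReal.ge_of_forall_gt_iff_ge]
  intro z hz
  obtain ⟨w, hzw, hw⟩ := EReal.lt_iff_exists_real_btwn.1 hz
  have hzw' := EReal.coe_lt_coe_iff.1 hzw
  have hev := hl _ hw
  have hpath : Tendsto (fun δ : ℝ => (R - δ, a - δ)) (𝓝[>] 0) (𝓝 (R, a)) := by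
    have : Continuous fun δ : ℝ => (R - δ, a - δ) := by fun_prop
    have h0 := this.tendsto 0
    simp only [sub_zero] at h0
    exact h0.mono_left nhdsWithin_le_nhds
  have hsmall : ∀ᶠ δ : ℝ in 𝓝[>] 0, δ < w - z :=
    nhdsWithin_le_nhds (eventually_lt_nhds (by linarith))
  obtain ⟨δ, h1, h2, h3⟩ :=
    ((hpath.eventually hev).and (hsmall.and self_mem_nhdsWithin)).exists
  refine le_trans ?_ (h δ h3)
  refine le_trans ?_ (EReal.sub_le_sub h1.le le_rfl)
  rw [← EReal.coe_sub, EReal.coe_le_coe_iff]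
  linarith

theorem sub_coe_le_self (E : EReal) {δ : ℝ} (hδ : 0 < δ) : E - (δ : EReal) ≤ E := by
  simpa using ereal_sub_coe_le_sub_coe E hδ.le

/-- Smaller slack makes the requirement on a code stronger, which is the nesting needed for the
diagonal choice. -/
theorem monotone_expRC_sub (P : X → ℝ) (W V : X → Y → ℝ) (R a : ℝ) {s t : ℝ} (h : s ≤ t) :
    expRC (R - t) (a - t) P W V - ((3 * t : ℝ) : EReal)
      ≤ expRC (R - s) (a - s) P W V - ((3 * s : ℝ) : EReal) := by
  have h1 := expRC_sub_le (r := R - t) (r' := R - s) (a := a - t) (a' := a - s)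
    (by linarith) (by linarith) P W V
  refine le_trans ?_ (EReal.sub_le_sub h1 le_rfl)
  rw [ereal_sub_coe_sub_coe]
  exact ereal_sub_coe_le_sub_coe _ (by linarith)

end Limits

end Exponents

end DetDec

end

/-! ### The main theorem. -/

open DetDec
theorem theorem3 {X Y : Type*} [Fintype X] [Fintype Y]
    (W V : X → Y → ℝ) (hW : IsChannel W) (hV : IsChannel V)
    (P : X → ℝ) (hP : P ∈ stdSimplex ℝ X)
    (R α : ℝ) (hR : 0 ≤ R) (hα : 0 ≤ α) :
    ∃ C : CodeSeq X R, ∀ δ : ℝ, 0 < δ →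
      (LowerSemicontinuousAt (fun p : ℝ × ℝ => expRC p.1 p.2 P W V) (R, α) →
        expRC R α P W V - (δ : EReal) ≤ exponentFA W V α C) ∧
      (LowerSemicontinuousAt (fun p : ℝ × ℝ => expRC p.1 p.2 P V W) (R, -α) →
        expRC R (-α) P V W - (δ : EReal) ≤ exponentMD W V α C) ∧
      expRC (R - δ) (α - δ) P W V - (δ : EReal) ≤ exponentFA W V α C ∧
      expRC (R - δ) (-α - δ) P V W - (δ : EReal) ≤ exponentMD W V α C := by
  classical
  have hW0 : ∀ a b, 0 ≤ W a b := fun a b => (hW a).1 b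
  have hV0 : ∀ a b, 0 ≤ V a b := fun a b => (hV a).1 b
  have hX : Nonempty X := by
    by_contra hne
    rw [not_nonempty_iff] at hne
    simpa using hP.2
  let u : ℕ → ℝ := fun k => 1 / ((k : ℝ) + 1)
  have hu0 : ∀ k, 0 < u k := fun k => by positivity
  have hu : Tendsto u atTop (𝓝 0) := tendsto_one_div_add_atTop_nhds_zero_nat
  have hanti : ∀ k l, k ≤ l → u l ≤ u k := fun k l h => by
    simp only [u]; gcongr
  obtain ⟨C, hC⟩ := exists_diagonal (A := fun n => Codebook X (codeSize R n) n)
    (G := fun k n c =>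
      expRC (R - u k) (α - u k) P W V - ((3 * u k : ℝ) : EReal)
        ≤ normExponent n (probFA W c (rejectL W V α c)) ∧
      expRC (R - u k) (-α - u k) P V W - ((3 * u k : ℝ) : EReal)
        ≤ normExponent n (probMD V c (rejectL W V α c)))
    (fun k l n c hkl h => ⟨(monotone_expRC_sub P W V R α (hanti k l hkl)).trans h.1,
      (monotone_expRC_sub P V W R (-α) (hanti k l hkl)).trans h.2⟩)
    fun k => eventually_exists_code hW0 hV0 hP hR α (hu0 k)
  have hFA : ∀ k, expRC (R - u k) (α - u k) P W V - ((3 * u k : ℝ) : EReal)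
      ≤ exponentFA W V α C := fun k =>
    le_liminf_of_le (by isBoundedDefault) ((hC k).mono fun n h => h.1)
  have hMD : ∀ k, expRC (R - u k) (-α - u k) P V W - ((3 * u k : ℝ) : EReal)
      ≤ exponentMD W V α C := fun k =>
    le_liminf_of_le (by isBoundedDefault) ((hC k).mono fun n h => h.2)
  have hFA' := fun (δ : ℝ) (hδ : 0 < δ) => expRC_sub_le_of_forall hu hFA hδ
  have hMD' := fun (δ : ℝ) (hδ : 0 < δ) => expRC_sub_le_of_forall hu hMD hδ
  -- Under lower semicontinuity the bound holds without loss; it is only weakened here by `δ`.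
  exact ⟨C, fun δ hδ => ⟨fun hl => (sub_coe_le_self _ hδ).trans
      (expRC_le_of_lowerSemicontinuousAt hl hFA'),
    fun hl => (sub_coe_le_self _ hδ).trans (expRC_le_of_lowerSemicontinuousAt hl hMD'),
    hFA' δ hδ, hMD' δ hδ⟩⟩
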